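/- For $x\in\mathbb R$ write $e(x)=e^{2\pi i x}$. Let $0<\alpha_1<1/2$ and let $\gamma_1,\dots,\gamma_4\in(0,1)$ be pairwise distinct. Let $T_0,T_1,T_\infty\in \mathrm{GL}_4(\mathbb C)$ be diagonalizable matrices with $T_0T_1T_\infty=I_4$ whose characteristic polynomials are $$q_0=(T-1)^2\,(T-e(\alpha_1))\,(T-e(1-\alpha_1)),\qquad q_1=(T-1)^2(T+1)^2,\qquad q_\infty=\prod_{i=1}^4 (T-e(\gamma_i)),$$ and assume that the group $\Gamma=\langle T_0,T_1,T_\infty\rangle$ acts irreducibly on $\mathbb C^4$. (Here $q_0$ and $q_1$ have real coefficients; $q_\infty$ may, but need not, have real coefficients.) Then there is a non-zero Hermitian form $H$ on $\mathbb C^4$ invariant under $\Gamma$, that is, a non-zero Hermitian matrix $H$ with $g^*Hg=H$ for all $g\in\Gamma$, and it is unique up to multiplication by a non-zero real number. Let $n_1$ be the number of indices $i$ with $\gamma_i\in(0,1/2)$, and let $n_2$ be the number of pairs $i<j$ for which the representative in $[0,1)$ of $\gamma_i+\gamma_j$ modulo $1$ lies in $(1/2-\alpha_1,\,1/2+\alpha_1)$.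 Then $H$ is definite (positive or negative) if and only if $(n_1,n_2)=(2,4)$. -/

import Mathlib

open scoped Matrix ComplexOrder

/-- The point of the unit circle with exponent `x`, that is `exp (2 π i x)`. -/
noncomputable def circleExp (x : ℝ) : ℂ :=
  Complex.exp (2 * (Real.pi : ℂ) * Complex.I * (x : ℂ))

/-- `(T₀, T₁, Tinf)` is the triple of local monodromies of a Goursat II system (partitions
`2 1 1`, `2 2`, `1 1 1 1`): the product is the identity, and the three matrices are
diagonalizable with spectra `(1, 1, a₁, a₂)`, `(1, 1, b, b)`, `(c₁, c₂, c₃, c₄)`, where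
eigenvalues with different labels at one puncture are distinct. -/
structure IsGoursatII (a₁ a₂ b : ℂ) (c : Fin 4 → ℂ) (T₀ T₁ Tinf : GL (Fin 4) ℂ) : Prop where
  a₁_ne_one : a₁ ≠ 1
  a₂_ne_one : a₂ ≠ 1
  a₁_ne_a₂ : a₁ ≠ a₂
  b_ne_one : b ≠ 1
  c_injective : Function.Injective c
  conj_zero : IsConj (T₀ : Matrix (Fin 4) (Fin 4) ℂ) (Matrix.diagonal ![1, 1, a₁, a₂])
  conj_one : IsConj (T₁ : Matrix (Fin 4) (Fin 4) ℂ) (Matrix.diagonal ![1, 1, b, b])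
  conj_inf : IsConj (Tinf : Matrix (Fin 4) (Fin 4) ℂ) (Matrix.diagonal c)
  prod_eq_one : T₀ * T₁ * Tinf = 1

/-- The geometric monodromy group, generated by the local monodromies. -/
def monodromyGroup (T₀ T₁ Tinf : GL (Fin 4) ℂ) : Subgroup (GL (Fin 4) ℂ) :=
  Subgroup.closure {T₀, T₁, Tinf}

/-- A subgroup of `GL₄(ℂ)` acts irreducibly on `ℂ⁴`. -/
def ActsIrreducibly (Γ : Subgroup (GL (Fin 4) ℂ)) : Prop :=
  ∀ W : Submodule ℂ (Fin 4 → ℂ),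
    (∀ g ∈ Γ, ∀ v ∈ W, (g : Matrix (Fin 4) (Fin 4) ℂ) *ᵥ v ∈ W) → W = ⊥ ∨ W = ⊤

/-- `H` is (the Gram matrix of) a non-zero Hermitian form invariant under `Γ`. -/
structure IsInvariantHermitianForm (Γ : Subgroup (GL (Fin 4) ℂ))
    (H : Matrix (Fin 4) (Fin 4) ℂ) : Prop where
  ne_zero : H ≠ 0
  isHermitian : H.IsHermitian
  invariant : ∀ g ∈ Γ,
    (g : Matrix (Fin 4) (Fin 4) ℂ)ᴴ * H * (g : Matrix (Fin 4) (Fin 4) ℂ) = H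

/-- A Hermitian form is definite if it is positive definite or negative definite. -/
def IsDefiniteForm (H : Matrix (Fin 4) (Fin 4) ℂ) : Prop :=
  H.PosDef ∨ (-H).PosDef

/-- `n₁`: the number of `γᵢ` in `(0, 1/2)`. -/
noncomputable def countHalf (γ : Fin 4 → ℝ) : ℕ :=
  {i : Fin 4 | γ i ∈ Set.Ioo (0 : ℝ) (1 / 2)}.ncard

/-- `n₂`: the number of pairs `i < j` such that the representative modulo `1` of `γᵢ + γⱼ`
lies in `(1/2 - α, 1/2 + α)` (used for `0 < α < 1/2`, so that the interval lies in `(0, 1)`). -/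
noncomputable def countPairs (α : ℝ) (γ : Fin 4 → ℝ) : ℕ :=
  {p : Fin 4 × Fin 4 | p.1 < p.2 ∧
    Int.fract (γ p.1 + γ p.2) ∈ Set.Ioo (1 / 2 - α) (1 / 2 + α)}.ncard

/-!
# Definiteness of the invariant Hermitian form of a Goursat II system

*Normal form.* Let `a = e(α)`. The covectors `r₀, r₁` with `r₀ T₀ = a r₀` and `r₁ T₀ = ā r₁`,
together with `r₀ T₁` and `r₁ T₁`, are the rows of a matrix `C` that intertwines `T₁` with the swap
of the two halves of `ℂ⁴` and `T₀` with the block matrix `[[A, 0], [X, 1]]`, where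
`A = diag(a, ā)` and `X` is a `2 × 2` matrix. The kernel of `C` is invariant, so `C` is invertible,
and irreducibility also forces both off-diagonal entries of `X` to be non-zero
(`exists_normalForm`). The characteristic polynomial of `T₀ T₁ = Tinf⁻¹` becomes
`det (t² - t X - A)`. Comparing it with the polynomial whose roots are the numbers `e(-γᵢ)` gives
`X₁₁ = ρ₁ (a - 1)`, `X₂₂ = ρ₂ (ā - 1)`, `X₁₂ X₂₁ = κ |a - 1|²` with real `ρ₁, ρ₂, κ`
(`exists_real_parameters`). The values of the characteristic polynomial at `±1` are
`|a - 1|² ((1 ± ρ₁) (1 ± ρ₂) - κ)`, and `κ` is a positive multiple of the product of the three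
factors `2 cos 2πα + 2 cos 2π(γ₀ + γⱼ)`, by the resolvent cubic of the quartic.

*The form.* In these coordinates `dualForm`, the block matrix `[[W, R], [R, W]]` with
`W = diag(1, ω)` and `R` Hermitian, satisfies `g Y g* = Y` for both generators. Its range is
invariant, so it is invertible, and its inverse is an invariant Hermitian form. Uniqueness is
Schur's lemma (`IsInvariantHermitianForm.eq_real_smul`), so only this form has to be tested. It is
definite if and only if `W + R` and `W - R` are positive definite, that is, if and only if `κ > 0`,
`|ρ₁| < 1` and `(1 ± ρ₁) (1 ± ρ₂) > κ` (`dualForm_isDefiniteForm_iff`).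

*The counts.* Since `∏ e(γᵢ) = 1`, the exponents add up to `1`, `2` or `3`, and complementary pairs
`{i, j}`, `{k, l}` give the same value `cos 2π(γᵢ + γⱼ) = cos 2π(γₖ + γₗ)`. A pair is counted by
`countPairs` exactly if its factor above is negative (`fract_mem_Ioo_iff_cos`), so `countPairs` is
twice the number of negative factors. The values at `±1` are, up to the common sign `(-1)^(∑ γᵢ)`,
the products `16 ∏ sin πγᵢ` and `16 ∏ cos πγᵢ`. If they are positive, the sum is `2` and two
exponents are smaller than `1/2`. Then `κ > 0` leaves zero or two negative factors, and
`one_add_cos_le_cos_add_cos` excludes zero. Conversely, with two negative factors `κ > 0` and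
`ρ₁ ρ₂ - κ < 1`, which excludes `|ρ₁| ≥ 1` (`positivity_iff_counts`).
-/

open ComplexConjugate

/-! ### Invariant subspaces and invariant forms -/

theorem mulVec_inv_mem_of_mulVec_mem (g : GL (Fin 4) ℂ) (W : Submodule ℂ (Fin 4 → ℂ))
    (h : ∀ v ∈ W, (g : Matrix (Fin 4) (Fin 4) ℂ) *ᵥ v ∈ W) :
    ∀ v ∈ W, ((g⁻¹ : GL (Fin 4) ℂ) : Matrix (Fin 4) (Fin 4) ℂ) *ᵥ v ∈ W := by
  intro v hv
  let f : W →ₗ[ℂ] W := (Matrix.mulVecLin (g : Matrix (Fin 4) (Fin 4) ℂ)).restrict h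
  have hf : ∀ u : W, ((f u : W) : Fin 4 → ℂ) =
      (g : Matrix (Fin 4) (Fin 4) ℂ) *ᵥ (u : Fin 4 → ℂ) := fun _ => rfl
  have hinj : Function.Injective f := by
    intro u u' huu
    refine Subtype.ext (Matrix.mulVec_injective_iff_isUnit.2 g.isUnit ?_)
    rw [← hf, ← hf, huu]
  obtain ⟨u, hu⟩ := LinearMap.injective_iff_surjective.1 hinj ⟨v, hv⟩
  have h2 : (g : Matrix (Fin 4) (Fin 4) ℂ) *ᵥ (u : Fin 4 → ℂ) = v := by
    rw [← hf, hu]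
  rw [← h2, Matrix.mulVec_mulVec, ← Units.val_mul, inv_mul_cancel, Units.val_one,
    Matrix.one_mulVec]
  exact u.2

/-- Irreducibility can be tested on `T₀` and `T₁`: a subspace stable under an invertible matrix is
stable under its inverse by a dimension count, and `Tinf = (T₀ T₁)⁻¹`. -/
theorem eq_bot_or_top_of_generators {T₀ T₁ Tinf : GL (Fin 4) ℂ} (hp : T₀ * T₁ * Tinf = 1)
    (hirr : ActsIrreducibly (monodromyGroup T₀ T₁ Tinf)) (W : Submodule ℂ (Fin 4 → ℂ))
    (h₀ : ∀ v ∈ W, (T₀ : Matrix (Fin 4) (Fin 4) ℂ) *ᵥ v ∈ W)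
    (h₁ : ∀ v ∈ W, (T₁ : Matrix (Fin 4) (Fin 4) ℂ) *ᵥ v ∈ W) : W = ⊥ ∨ W = ⊤ := by
  have h01 : ∀ v ∈ W, ((T₀ * T₁ : GL (Fin 4) ℂ) : Matrix (Fin 4) (Fin 4) ℂ) *ᵥ v ∈ W := by
    intro v hv
    rw [Units.val_mul, ← Matrix.mulVec_mulVec]
    exact h₀ _ (h₁ _ hv)
  refine hirr W fun g hg => ?_
  induction hg using Subgroup.closure_induction with
  | mem g hg =>
    rcases hg with rfl | rfl | rfl
    · exact h₀
    · exact h₁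
    · rw [eq_inv_of_mul_eq_one_right hp]
      exact mulVec_inv_mem_of_mulVec_mem _ W h01
  | one => intro v hv; simpa using hv
  | mul g g' _ _ hg hg' =>
    intro v hv
    rw [Units.val_mul, ← Matrix.mulVec_mulVec]
    exact hg _ (hg' _ hv)
  | inv g _ hg => exact mulVec_inv_mem_of_mulVec_mem g W hg

theorem invariant_of_generators {T₀ T₁ Tinf : GL (Fin 4) ℂ} (hp : T₀ * T₁ * Tinf = 1)
    {H : Matrix (Fin 4) (Fin 4) ℂ}
    (h₀ : (T₀ : Matrix (Fin 4) (Fin 4) ℂ)ᴴ * H * (T₀ : Matrix (Fin 4) (Fin 4) ℂ) = H)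
    (h₁ : (T₁ : Matrix (Fin 4) (Fin 4) ℂ)ᴴ * H * (T₁ : Matrix (Fin 4) (Fin 4) ℂ) = H) :
    ∀ g ∈ monodromyGroup T₀ T₁ Tinf,
      (g : Matrix (Fin 4) (Fin 4) ℂ)ᴴ * H * (g : Matrix (Fin 4) (Fin 4) ℂ) = H := by
  have hmul : ∀ g g' : GL (Fin 4) ℂ,
      (g : Matrix (Fin 4) (Fin 4) ℂ)ᴴ * H * (g : Matrix (Fin 4) (Fin 4) ℂ) = H →
      (g' : Matrix (Fin 4) (Fin 4) ℂ)ᴴ * H * (g' : Matrix (Fin 4) (Fin 4) ℂ) = H →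
      ((g * g' : GL (Fin 4) ℂ) : Matrix (Fin 4) (Fin 4) ℂ)ᴴ * H *
        ((g * g' : GL (Fin 4) ℂ) : Matrix (Fin 4) (Fin 4) ℂ) = H := by
    intro g g' hg hg'
    rw [Units.val_mul, Matrix.conjTranspose_mul]
    calc _ = (g' : Matrix (Fin 4) (Fin 4) ℂ)ᴴ * ((g : Matrix (Fin 4) (Fin 4) ℂ)ᴴ * H *
          (g : Matrix (Fin 4) (Fin 4) ℂ)) * (g' : Matrix (Fin 4) (Fin 4) ℂ) := by
          simp only [Matrix.mul_assoc]
      _ = H := by rw [hg, hg']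
  have hinv : ∀ g : GL (Fin 4) ℂ,
      (g : Matrix (Fin 4) (Fin 4) ℂ)ᴴ * H * (g : Matrix (Fin 4) (Fin 4) ℂ) = H →
      ((g⁻¹ : GL (Fin 4) ℂ) : Matrix (Fin 4) (Fin 4) ℂ)ᴴ * H *
        ((g⁻¹ : GL (Fin 4) ℂ) : Matrix (Fin 4) (Fin 4) ℂ) = H := by
    intro g hg
    have h1 : (g : Matrix (Fin 4) (Fin 4) ℂ) *
        ((g⁻¹ : GL (Fin 4) ℂ) : Matrix (Fin 4) (Fin 4) ℂ) = 1 := by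
      rw [← Units.val_mul, mul_inv_cancel, Units.val_one]
    have h2 : ((g⁻¹ : GL (Fin 4) ℂ) : Matrix (Fin 4) (Fin 4) ℂ)ᴴ *
        (g : Matrix (Fin 4) (Fin 4) ℂ)ᴴ = 1 := by
      rw [← Matrix.conjTranspose_mul, h1, Matrix.conjTranspose_one]
    conv_lhs => rw [← hg]
    calc _ = (((g⁻¹ : GL (Fin 4) ℂ) : Matrix (Fin 4) (Fin 4) ℂ)ᴴ *
        (g : Matrix (Fin 4) (Fin 4) ℂ)ᴴ) * H * ((g : Matrix (Fin 4) (Fin 4) ℂ) *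
        ((g⁻¹ : GL (Fin 4) ℂ) : Matrix (Fin 4) (Fin 4) ℂ)) := by
          simp only [Matrix.mul_assoc]
      _ = H := by rw [h1, h2, Matrix.one_mul, Matrix.mul_one]
  intro g hg
  induction hg using Subgroup.closure_induction with
  | mem g hg =>
    rcases hg with rfl | rfl | rfl
    · exact h₀
    · exact h₁
    · rw [eq_inv_of_mul_eq_one_right hp]
      exact hinv _ (hmul _ _ h₀ h₁)
  | one => simp
  | mul g g' _ _ hg hg' => exact hmul g g' hg hg'
  | inv g _ hg => exact hinv g hg

/-- The kernel of an invariant sesquilinear form is an invariant subspace, so under irreducibility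
a degenerate invariant form vanishes. -/
theorem eq_zero_of_invariant_of_det_eq_zero {Γ : Subgroup (GL (Fin 4) ℂ)}
    (hirr : ActsIrreducibly Γ) {H : Matrix (Fin 4) (Fin 4) ℂ}
    (hinv : ∀ g ∈ Γ, (g : Matrix (Fin 4) (Fin 4) ℂ)ᴴ * H * (g : Matrix (Fin 4) (Fin 4) ℂ) = H)
    (hdet : H.det = 0) : H = 0 := by
  have hker : ∀ g ∈ Γ, ∀ v ∈ LinearMap.ker H.mulVecLin,
      (g : Matrix (Fin 4) (Fin 4) ℂ) *ᵥ v ∈ LinearMap.ker H.mulVecLin := by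
    intro g hg v hv
    simp only [LinearMap.mem_ker, Matrix.mulVecLin_apply] at hv ⊢
    have hu : IsUnit (g : Matrix (Fin 4) (Fin 4) ℂ)ᴴ :=
      (Matrix.isUnit_conjTranspose _).2 g.isUnit
    apply Matrix.mulVec_injective_iff_isUnit.2 hu
    rw [Matrix.mulVec_mulVec, Matrix.mulVec_mulVec, hinv g hg, hv,
      Matrix.mulVec_zero]
  rcases hirr _ hker with h | h
  · obtain ⟨v, hv, hv'⟩ := Matrix.exists_mulVec_eq_zero_iff.2 hdet
    have : v ∈ LinearMap.ker H.mulVecLin := by simpa using hv'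
    rw [h] at this
    exact absurd (by simpa using this) hv
  · rw [LinearMap.ker_eq_top] at h
    ext i j
    simpa using congrFun (LinearMap.congr_fun h (Pi.single j 1)) i

/-- Schur's lemma for forms: the pencil `H' - μ H` is degenerate for some `μ`, hence zero. -/
theorem IsInvariantHermitianForm.eq_real_smul {Γ : Subgroup (GL (Fin 4) ℂ)}
    (hirr : ActsIrreducibly Γ) {H H' : Matrix (Fin 4) (Fin 4) ℂ}
    (h : IsInvariantHermitianForm Γ H) (h' : IsInvariantHermitianForm Γ H') :
    ∃ r : ℝ, r ≠ 0 ∧ H' = (r : ℂ) • H := by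
  have hdet : H.det ≠ 0 := fun h0 =>
    h.ne_zero (eq_zero_of_invariant_of_det_eq_zero hirr h.invariant h0)
  obtain ⟨μ, hμ⟩ := Module.End.exists_eigenvalue (Matrix.toLin' (H⁻¹ * H'))
  obtain ⟨v, hv⟩ := hμ.exists_hasEigenvector
  have hv1 : (H' - μ • H) *ᵥ v = 0 := by
    have h1 := hv.apply_eq_smul
    rw [Matrix.toLin'_apply] at h1
    have h2 := congrArg (fun t => H *ᵥ t) h1
    simp only [Matrix.mulVec_mulVec, ← Matrix.mul_assoc] at h2
    rw [Matrix.mul_nonsing_inv _ (Ne.isUnit hdet), Matrix.one_mul, Matrix.mulVec_smul] at h2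
    rw [Matrix.sub_mulVec, h2, Matrix.smul_mulVec, sub_self]
  have hz : H' - μ • H = 0 := by
    refine eq_zero_of_invariant_of_det_eq_zero hirr ?_
      (Matrix.exists_mulVec_eq_zero_iff.1 ⟨v, hv.2, hv1⟩)
    intro g hg
    rw [Matrix.mul_sub, Matrix.sub_mul, h'.invariant g hg, Matrix.mul_smul, Matrix.smul_mul,
      h.invariant g hg]
  have hH' : H' = μ • H := sub_eq_zero.1 hz
  have hconj : star μ • H = μ • H := by
    have h1 := h'.isHermitian.eq
    rw [hH', Matrix.conjTranspose_smul, h.isHermitian.eq] at h1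
    exact h1
  have hμr : star μ = μ := smul_left_injective ℂ h.ne_zero hconj
  have hre : ((μ.re : ℝ) : ℂ) = μ := Complex.conj_eq_iff_re.1 hμr
  refine ⟨μ.re, ?_, by rw [hre, hH']⟩
  intro h0
  rw [h0, Complex.ofReal_zero] at hre
  exact h'.ne_zero (by rw [hH', ← hre, zero_smul])

theorem isDefiniteForm_real_smul_iff {r : ℝ} (hr : r ≠ 0) {H : Matrix (Fin 4) (Fin 4) ℂ} :
    IsDefiniteForm ((r : ℂ) • H) ↔ IsDefiniteForm H := by
  have key : ∀ (s : ℝ) (_ : s ≠ 0) (K : Matrix (Fin 4) (Fin 4) ℂ),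
      IsDefiniteForm K → IsDefiniteForm ((s : ℂ) • K) := by
    intro s hs K hK
    rcases lt_or_gt_of_ne hs with h | h
    · have hs' : (0 : ℂ) < ((-s : ℝ) : ℂ) := by exact_mod_cast neg_pos.2 h
      rcases hK with hK | hK
      · right
        have := hK.smul hs'
        simpa using this
      · left
        have := hK.smul hs'
        simpa using this
    · have hs' : (0 : ℂ) < (s : ℂ) := by exact_mod_cast h
      rcases hK with hK | hK
      · exact Or.inl (hK.smul hs')
      · right
        have := hK.smul hs'
        simpa using this
  refine ⟨fun h => ?_, key r hr H⟩
  have h1 := key r⁻¹ (inv_ne_zero hr) _ h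
  rwa [smul_smul, ← Complex.ofReal_mul, inv_mul_cancel₀ hr, Complex.ofReal_one, one_smul] at h1

/-- A form `Y` on the dual space, invariant in the sense `T Y T* = Y`: under irreducibility it is
nondegenerate, since its range is an invariant subspace. -/
theorem isUnit_of_dual_invariant {T₀ T₁ Tinf : GL (Fin 4) ℂ} (hp : T₀ * T₁ * Tinf = 1)
    (hirr : ActsIrreducibly (monodromyGroup T₀ T₁ Tinf)) {Y : Matrix (Fin 4) (Fin 4) ℂ}
    (hY : Y ≠ 0)
    (h₀ : (T₀ : Matrix (Fin 4) (Fin 4) ℂ) * Y * (T₀ : Matrix (Fin 4) (Fin 4) ℂ)ᴴ = Y)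
    (h₁ : (T₁ : Matrix (Fin 4) (Fin 4) ℂ) * Y * (T₁ : Matrix (Fin 4) (Fin 4) ℂ)ᴴ = Y) :
    IsUnit Y := by
  have hst : ∀ g : GL (Fin 4) ℂ,
      (g : Matrix (Fin 4) (Fin 4) ℂ) * Y * (g : Matrix (Fin 4) (Fin 4) ℂ)ᴴ = Y →
      ∀ v ∈ LinearMap.range Y.mulVecLin,
        (g : Matrix (Fin 4) (Fin 4) ℂ) *ᵥ v ∈ LinearMap.range Y.mulVecLin := by
    rintro g hg _ ⟨u, rfl⟩
    have hu : IsUnit (g : Matrix (Fin 4) (Fin 4) ℂ)ᴴ :=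
      (Matrix.isUnit_conjTranspose _).2 g.isUnit
    obtain ⟨u', rfl⟩ := Matrix.mulVec_surjective_iff_isUnit.2 hu u
    refine ⟨u', ?_⟩
    simp only [Matrix.mulVecLin_apply, Matrix.mulVec_mulVec]
    rw [← Matrix.mul_assoc, hg]
  rcases eq_bot_or_top_of_generators hp hirr _ (hst _ h₀) (hst _ h₁) with h | h
  · rw [LinearMap.range_eq_bot] at h
    refine absurd ?_ hY
    ext i j
    simpa using congrFun (LinearMap.congr_fun h (Pi.single j 1)) i
  · rw [← Matrix.mulVec_surjective_iff_isUnit]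
    intro v
    exact LinearMap.range_eq_top.1 h v

theorem inv_invariant_of_dual_invariant {g Y : Matrix (Fin 4) (Fin 4) ℂ}
    (hY : IsUnit Y) (h : g * Y * gᴴ = Y) : gᴴ * Y⁻¹ * g = Y⁻¹ := by
  have hd : IsUnit Y.det := (Matrix.isUnit_iff_isUnit_det _).1 hY
  have h1 : g * (Y * gᴴ * Y⁻¹) = 1 := by
    rw [← Matrix.mul_assoc, ← Matrix.mul_assoc, h, Matrix.mul_nonsing_inv _ hd]
  have h2 := mul_eq_one_comm.1 h1
  calc gᴴ * Y⁻¹ * g = Y⁻¹ * (Y * gᴴ * Y⁻¹ * g) := by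
        simp only [← Matrix.mul_assoc, Matrix.nonsing_inv_mul _ hd, Matrix.one_mul]
    _ = Y⁻¹ := by rw [h2, Matrix.mul_one]

theorem isDefiniteForm_inv_iff {Y : Matrix (Fin 4) (Fin 4) ℂ} (hY : IsUnit Y) :
    IsDefiniteForm Y⁻¹ ↔ IsDefiniteForm Y := by
  have h : -Y⁻¹ = (-Y)⁻¹ := by
    rw [← neg_one_smul ℂ Y, ← neg_one_smul ℂ Y⁻¹]
    have := Matrix.inv_smul' Y (-1 : ℂˣ) ((Matrix.isUnit_iff_isUnit_det _).1 hY)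
    simpa [Units.smul_def] using this.symm
  rw [IsDefiniteForm, h, Matrix.posDef_inv_iff, Matrix.posDef_inv_iff, IsDefiniteForm]

theorem isDefiniteForm_mul_mul_conjTranspose_iff {B Y : Matrix (Fin 4) (Fin 4) ℂ}
    (hB : IsUnit B) : IsDefiniteForm (B * Y * Bᴴ) ↔ IsDefiniteForm Y := by
  have h : -(B * Y * Bᴴ) = B * (-Y) * Bᴴ := by rw [Matrix.mul_neg, Matrix.neg_mul]
  rw [IsDefiniteForm, h, ← Matrix.star_eq_conjTranspose,
    Matrix.IsUnit.posDef_star_right_conjugate_iff hB,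
    Matrix.IsUnit.posDef_star_right_conjugate_iff hB, IsDefiniteForm]

/-! ### The normal form -/

/-- The normal form of the involution `T₁`: it swaps the two halves of `ℂ⁴`. -/
def blockSwap : Matrix (Fin 4) (Fin 4) ℂ :=
  !![0, 0, 1, 0; 0, 0, 0, 1; 1, 0, 0, 0; 0, 1, 0, 0]

/-- The normal form of `T₀`: the block matrix `[[A, 0], [X, 1]]` with `A = diag(a, b)` and
`X = [[x, y], [z, w]]`. -/
def blockLower (a b x y z w : ℂ) : Matrix (Fin 4) (Fin 4) ℂ :=
  !![a, 0, 0, 0; 0, b, 0, 0; x, y, 1, 0; z, w, 0, 1]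

/-- The normal form. The rows of `C` are the eigen-covectors of `T₀` for `a` and `b`, and their
images under the involution `T₁`. -/
theorem exists_normalForm {a b : ℂ} {c : Fin 4 → ℂ} {T₀ T₁ Tinf : GL (Fin 4) ℂ}
    (hT : IsGoursatII a b (-1) c T₀ T₁ Tinf)
    (hirr : ActsIrreducibly (monodromyGroup T₀ T₁ Tinf)) :
    ∃ (C : Matrix (Fin 4) (Fin 4) ℂ) (x y z w : ℂ), IsUnit C ∧
      C * (T₀ : Matrix (Fin 4) (Fin 4) ℂ) = blockLower a b x y z w * C ∧
      C * (T₁ : Matrix (Fin 4) (Fin 4) ℂ) = blockSwap * C ∧ y ≠ 0 ∧ z ≠ 0 := by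
  obtain ⟨c₀, hc₀⟩ := hT.conj_zero
  obtain ⟨c₁, hc₁⟩ := hT.conj_one
  have hc₀' : (c₀ : Matrix (Fin 4) (Fin 4) ℂ) * (T₀ : Matrix (Fin 4) (Fin 4) ℂ) =
    Matrix.diagonal ![1, 1, a, b] * (c₀ : Matrix (Fin 4) (Fin 4) ℂ) := hc₀
  have hc₁' : (c₁ : Matrix (Fin 4) (Fin 4) ℂ) * (T₁ : Matrix (Fin 4) (Fin 4) ℂ) =
    Matrix.diagonal ![1, 1, -1, -1] * (c₁ : Matrix (Fin 4) (Fin 4) ℂ) := hc₁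
  have hinv : (T₁ : Matrix (Fin 4) (Fin 4) ℂ) * (T₁ : Matrix (Fin 4) (Fin 4) ℂ) = 1 := by
    have h1 : (c₁ : Matrix (Fin 4) (Fin 4) ℂ) *
        ((T₁ : Matrix (Fin 4) (Fin 4) ℂ) * (T₁ : Matrix (Fin 4) (Fin 4) ℂ)) = c₁ * 1 := by
      rw [← Matrix.mul_assoc, hc₁', Matrix.mul_assoc, hc₁', ← Matrix.mul_assoc,
        Matrix.diagonal_mul_diagonal, Matrix.mul_one]
      have : (fun i => (![1, 1, -1, -1] : Fin 4 → ℂ) i * (![1, 1, -1, -1] : Fin 4 → ℂ) i) =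
          fun _ => 1 := by
        ext i; fin_cases i <;> simp
      rw [this, Matrix.diagonal_one, Matrix.one_mul]
    exact c₁.isUnit.mul_left_cancel h1
  -- The eigen-covectors of `T₀` for `a` and `b`.
  let r : Fin 4 → Fin 4 → ℂ := (c₀ : Matrix (Fin 4) (Fin 4) ℂ)
  have hr : ∀ i, r i ᵥ* (T₀ : Matrix (Fin 4) (Fin 4) ℂ) = (![1, 1, a, b] : Fin 4 → ℂ) i • r i := by
    intro i
    have h1 := congrFun hc₀' i
    rw [Matrix.mul_apply_eq_vecMul] at h1
    rw [show r i = (c₀ : Matrix (Fin 4) (Fin 4) ℂ) i from rfl, h1]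
    ext j
    simp [Matrix.diagonal_mul]
  have hexp : ∀ u : Fin 4 → ℂ, ∃ x y : ℂ,
      u ᵥ* (T₀ : Matrix (Fin 4) (Fin 4) ℂ) = x • r 2 + y • r 3 + u := by
    intro u
    obtain ⟨t, rfl⟩ : ∃ t : Fin 4 → ℂ, t ᵥ* (c₀ : Matrix (Fin 4) (Fin 4) ℂ) = u :=
      ⟨u ᵥ* ((c₀⁻¹ : GL (Fin 4) ℂ) : Matrix (Fin 4) (Fin 4) ℂ), by
        rw [Matrix.vecMul_vecMul, ← Units.val_mul, inv_mul_cancel, Units.val_one,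
          Matrix.vecMul_one]⟩
    refine ⟨t 2 * (a - 1), t 3 * (b - 1), ?_⟩
    rw [Matrix.vecMul_vecMul, hc₀', ← Matrix.vecMul_vecMul]
    ext j
    simp only [Matrix.vecMul, dotProduct, Fin.sum_univ_four, Matrix.diagonal, Pi.add_apply,
      Pi.smul_apply, smul_eq_mul, r]
    simp
    ring
  obtain ⟨x, y, hxy⟩ := hexp (r 2 ᵥ* (T₁ : Matrix (Fin 4) (Fin 4) ℂ))
  obtain ⟨z, w, hzw⟩ := hexp (r 3 ᵥ* (T₁ : Matrix (Fin 4) (Fin 4) ℂ))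
  let C : Matrix (Fin 4) (Fin 4) ℂ := Matrix.of ![r 2, r 3,
    r 2 ᵥ* (T₁ : Matrix (Fin 4) (Fin 4) ℂ), r 3 ᵥ* (T₁ : Matrix (Fin 4) (Fin 4) ℂ)]
  have hC₀ : C * (T₀ : Matrix (Fin 4) (Fin 4) ℂ) = blockLower a b x y z w * C := by
    refine funext fun i => ?_
    rw [Matrix.mul_apply_eq_vecMul, Matrix.mul_apply_eq_vecMul]
    have h2 := hr 2
    have h3 := hr 3
    fin_cases i
    · change r 2 ᵥ* _ = _
      rw [h2]
      ext j
      simp [Matrix.vecMul, dotProduct, Fin.sum_univ_four, blockLower, C]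
    · change r 3 ᵥ* _ = _
      rw [h3]
      ext j
      simp [Matrix.vecMul, dotProduct, Fin.sum_univ_four, blockLower, C]
    · change (r 2 ᵥ* (T₁ : Matrix (Fin 4) (Fin 4) ℂ)) ᵥ* _ = _
      rw [hxy]
      ext j
      simp [Matrix.vecMul, dotProduct, Fin.sum_univ_four, blockLower, C]
    · change (r 3 ᵥ* (T₁ : Matrix (Fin 4) (Fin 4) ℂ)) ᵥ* _ = _
      rw [hzw]
      ext j
      simp [Matrix.vecMul, dotProduct, Fin.sum_univ_four, blockLower, C]
  have hC₁ : C * (T₁ : Matrix (Fin 4) (Fin 4) ℂ) = blockSwap * C := by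
    refine funext fun i => ?_
    rw [Matrix.mul_apply_eq_vecMul, Matrix.mul_apply_eq_vecMul]
    fin_cases i
    · ext j
      simp [Matrix.vecMul, dotProduct, Fin.sum_univ_four, blockSwap, C]
    · ext j
      simp [Matrix.vecMul, dotProduct, Fin.sum_univ_four, blockSwap, C]
    · change (r 2 ᵥ* (T₁ : Matrix (Fin 4) (Fin 4) ℂ)) ᵥ* _ = _
      rw [Matrix.vecMul_vecMul, hinv, Matrix.vecMul_one]
      ext j
      simp [Matrix.vecMul, dotProduct, Fin.sum_univ_four, blockSwap, C]
    · change (r 3 ᵥ* (T₁ : Matrix (Fin 4) (Fin 4) ℂ)) ᵥ* _ = _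
      rw [Matrix.vecMul_vecMul, hinv, Matrix.vecMul_one]
      ext j
      simp [Matrix.vecMul, dotProduct, Fin.sum_univ_four, blockSwap, C]
  -- A subspace cut out by a matrix intertwined with `T₀` and `T₁` is invariant.
  have hker : ∀ (W : Submodule ℂ (Fin 4 → ℂ)),
      (∀ v ∈ W, blockLower a b x y z w *ᵥ v ∈ W) → (∀ v ∈ W, blockSwap *ᵥ v ∈ W) →
      W.comap C.mulVecLin = ⊥ ∨ W.comap C.mulVecLin = ⊤ := by
    intro W h0 h1
    refine eq_bot_or_top_of_generators hT.prod_eq_one hirr _ ?_ ?_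
    · intro v hv
      simp only [Submodule.mem_comap, Matrix.mulVecLin_apply, Matrix.mulVec_mulVec] at hv ⊢
      rw [hC₀, ← Matrix.mulVec_mulVec]
      exact h0 _ hv
    · intro v hv
      simp only [Submodule.mem_comap, Matrix.mulVecLin_apply, Matrix.mulVec_mulVec] at hv ⊢
      rw [hC₁, ← Matrix.mulVec_mulVec]
      exact h1 _ hv
  have hCinj : Function.Injective C.mulVec := by
    rcases hker ⊥ (by simp) (by simp) with h | h
    · exact LinearMap.ker_eq_bot.1 h
    · exfalso
      have h0 : r 2 = 0 := by
        ext j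
        have h1 : (Pi.single j 1 : Fin 4 → ℂ) ∈ (⊥ : Submodule ℂ (Fin 4 → ℂ)).comap C.mulVecLin :=
          h ▸ Submodule.mem_top
        have h2 := congrFun ((Submodule.mem_bot ℂ).1 h1) 0
        simpa [C] using h2
      have h1 : r 2 ᵥ* ((c₀⁻¹ : GL (Fin 4) ℂ) : Matrix (Fin 4) (Fin 4) ℂ) = 0 := by
        rw [h0, Matrix.zero_vecMul]
      have h2 := congrFun (congrFun (Units.mul_inv c₀) 2) 2
      rw [Matrix.mul_apply_eq_vecMul] at h2
      have h3 : (0 : Fin 4 → ℂ) 2 = (1 : Matrix (Fin 4) (Fin 4) ℂ) 2 2 := by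
        rw [← h1]; exact h2
      simp at h3
  have hCu : IsUnit C := Matrix.mulVec_injective_iff_isUnit.1 hCinj
  have hCs : Function.Surjective C.mulVec := Matrix.mulVec_surjective_iff_isUnit.2 hCu
  have hproper : ∀ (W : Submodule ℂ (Fin 4 → ℂ)) (u u' : Fin 4 → ℂ), u ∈ W → u ≠ 0 → u' ∉ W →
      ¬ (W.comap C.mulVecLin = ⊥ ∨ W.comap C.mulVecLin = ⊤) := by
    rintro W u u' hu hu0 hu' (h | h)
    · obtain ⟨v, rfl⟩ := hCs u
      have : v ∈ W.comap C.mulVecLin := hu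
      rw [h, Submodule.mem_bot] at this
      exact hu0 (by rw [this, Matrix.mulVec_zero])
    · obtain ⟨v, rfl⟩ := hCs u'
      have : v ∈ W.comap C.mulVecLin := h ▸ Submodule.mem_top
      exact hu' this
  refine ⟨C, x, y, z, w, hCu, hC₀, hC₁, ?_, ?_⟩
  · -- If `y = 0`, the plane with vanishing first and third coordinates is invariant.
    intro hy
    let W : Submodule ℂ (Fin 4 → ℂ) :=
      LinearMap.ker (LinearMap.proj 0) ⊓ LinearMap.ker (LinearMap.proj 2)
    refine hproper W (Pi.single 1 1) (Pi.single 0 1) ?_ ?_ ?_ (hker W ?_ ?_)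
    · simp [W]
    · simp
    · simp [W]
    · rintro v ⟨hv0, hv2⟩
      simp only [SetLike.mem_coe, LinearMap.mem_ker, LinearMap.proj_apply] at hv0 hv2
      simp [W, blockLower, dotProduct, Fin.sum_univ_four, hv0, hv2, hy]
    · rintro v ⟨hv0, hv2⟩
      simp only [SetLike.mem_coe, LinearMap.mem_ker, LinearMap.proj_apply] at hv0 hv2
      simp [W, blockSwap, dotProduct, Fin.sum_univ_four, hv0, hv2]
  · -- If `z = 0`, the plane with vanishing second and fourth coordinates is invariant.
    intro hz
    let W : Submodule ℂ (Fin 4 → ℂ) :=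
      LinearMap.ker (LinearMap.proj 1) ⊓ LinearMap.ker (LinearMap.proj 3)
    refine hproper W (Pi.single 0 1) (Pi.single 1 1) ?_ ?_ ?_ (hker W ?_ ?_)
    · simp [W]
    · simp
    · simp [W]
    · rintro v ⟨hv0, hv2⟩
      simp only [SetLike.mem_coe, LinearMap.mem_ker, LinearMap.proj_apply] at hv0 hv2
      simp [W, blockLower, dotProduct, Fin.sum_univ_four, hv0, hv2, hz]
    · rintro v ⟨hv0, hv2⟩
      simp only [SetLike.mem_coe, LinearMap.mem_ker, LinearMap.proj_apply] at hv0 hv2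
      simp [W, blockSwap, dotProduct, Fin.sum_univ_four, hv0, hv2]

/-- The characteristic polynomial of `T₀ T₁ = Tinf⁻¹` in the normal form is the determinant of the
quadratic pencil `t² - t X - A`. -/
theorem normalForm_charpoly {a b : ℂ} {c : Fin 4 → ℂ} {T₀ T₁ Tinf : GL (Fin 4) ℂ}
    (hT : IsGoursatII a b (-1) c T₀ T₁ Tinf) (hc : ∀ i, c i ≠ 0)
    {C : Matrix (Fin 4) (Fin 4) ℂ} {x y z w : ℂ} (hC : IsUnit C)
    (h₀ : C * (T₀ : Matrix (Fin 4) (Fin 4) ℂ) = blockLower a b x y z w * C)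
    (h₁ : C * (T₁ : Matrix (Fin 4) (Fin 4) ℂ) = blockSwap * C) (t : ℂ) :
    (t ^ 2 - t * x - a) * (t ^ 2 - t * w - b) - t ^ 2 * (y * z) =
      (t - (c 0)⁻¹) * (t - (c 1)⁻¹) * (t - (c 2)⁻¹) * (t - (c 3)⁻¹) := by
  obtain ⟨k, hk⟩ := hT.conj_inf
  have hk' : (k : Matrix (Fin 4) (Fin 4) ℂ) * (Tinf : Matrix (Fin 4) (Fin 4) ℂ) =
    Matrix.diagonal c * (k : Matrix (Fin 4) (Fin 4) ℂ) := hk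
  have hp : (Tinf : Matrix (Fin 4) (Fin 4) ℂ) *
      ((T₀ : Matrix (Fin 4) (Fin 4) ℂ) * (T₁ : Matrix (Fin 4) (Fin 4) ℂ)) = 1 := by
    rw [← Units.val_mul, ← Units.val_mul, mul_eq_one_comm.1 hT.prod_eq_one, Units.val_one]
  have hdiag : Matrix.diagonal (fun i => (c i)⁻¹) * Matrix.diagonal c = 1 := by
    rw [Matrix.diagonal_mul_diagonal]
    simp [hc]
  have hk2 : (k : Matrix (Fin 4) (Fin 4) ℂ) *
      ((T₀ : Matrix (Fin 4) (Fin 4) ℂ) * (T₁ : Matrix (Fin 4) (Fin 4) ℂ)) =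
      Matrix.diagonal (fun i => (c i)⁻¹) * (k : Matrix (Fin 4) (Fin 4) ℂ) := by
    have h1 := congrArg (fun M => Matrix.diagonal (fun i => (c i)⁻¹) * (M *
      ((T₀ : Matrix (Fin 4) (Fin 4) ℂ) * (T₁ : Matrix (Fin 4) (Fin 4) ℂ)))) hk'
    rw [Matrix.mul_assoc (k : Matrix (Fin 4) (Fin 4) ℂ), hp, Matrix.mul_one, Matrix.mul_assoc,
      ← Matrix.mul_assoc _ (Matrix.diagonal c), hdiag, Matrix.one_mul] at h1
    exact h1.symm
  have hC2 : C * ((T₀ : Matrix (Fin 4) (Fin 4) ℂ) * (T₁ : Matrix (Fin 4) (Fin 4) ℂ)) =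
      (blockLower a b x y z w * blockSwap) * C := by
    rw [← Matrix.mul_assoc, h₀, Matrix.mul_assoc, h₁, Matrix.mul_assoc]
  have hdet : ∀ B M N : Matrix (Fin 4) (Fin 4) ℂ, IsUnit B → B * M = N * B →
      (t • 1 - M).det = (t • 1 - N).det := by
    intro B M N hB h
    have h1 : B * (t • 1 - M) = (t • 1 - N) * B := by
      rw [Matrix.mul_sub, Matrix.sub_mul, h, Matrix.mul_smul, Matrix.smul_mul, Matrix.mul_one,
        Matrix.one_mul]
    have h2 := congrArg Matrix.det h1
    rw [Matrix.det_mul, Matrix.det_mul, mul_comm] at h2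
    exact mul_right_cancel₀ ((Matrix.isUnit_iff_isUnit_det _).1 hB).ne_zero h2
  have hL : (t • 1 - blockLower a b x y z w * blockSwap).det =
      (t ^ 2 - t * x - a) * (t ^ 2 - t * w - b) - t ^ 2 * (y * z) := by
    have : t • 1 - blockLower a b x y z w * blockSwap =
        !![t, 0, -a, 0; 0, t, 0, -b; -1, 0, t - x, -y; 0, -1, -z, t - w] := by
      ext i j
      fin_cases i <;> fin_cases j <;>
        simp [blockLower, blockSwap]
    rw [this]
    simp [Matrix.det_succ_row_zero, Fin.sum_univ_succ, Fin.succAbove]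
    ring
  have hR : (t • 1 - Matrix.diagonal (fun i => (c i)⁻¹)).det =
      (t - (c 0)⁻¹) * (t - (c 1)⁻¹) * (t - (c 2)⁻¹) * (t - (c 3)⁻¹) := by
    have : t • 1 - Matrix.diagonal (fun i => (c i)⁻¹) =
        Matrix.diagonal (fun i => t - (c i)⁻¹) := by
      rw [Matrix.smul_one_eq_diagonal, Matrix.diagonal_sub]
    rw [this, Matrix.det_diagonal, Fin.prod_univ_four]
  rw [← hL, ← hR, ← hdet C _ _ hC hC2, hdet _ _ _ k.isUnit hk2]

/-! ### Real parameters of the normal form -/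

/-- The entries of `X` in terms of the eigenvalues `l₀, …, l₃` of `T₀ T₁`. The last identity is
the resolvent cubic of the quartic with roots `l₀, …, l₃`, evaluated at `-(a + conj a)`. -/
theorem exists_real_parameters {a x y z w l₀ l₁ l₂ l₃ : ℂ} (ha : a * conj a = 1)
    (ha' : a ≠ conj a) (hl₀ : l₀ * conj l₀ = 1) (hl₁ : l₁ * conj l₁ = 1)
    (hl₂ : l₂ * conj l₂ = 1) (hl₃ : l₃ * conj l₃ = 1)
    (hpoly : ∀ t : ℂ, (t ^ 2 - t * x - a) * (t ^ 2 - t * w - conj a) - t ^ 2 * (y * z) =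
      (t - l₀) * (t - l₁) * (t - l₂) * (t - l₃)) :
    ∃ ρ₁ ρ₂ κ : ℝ, x = ρ₁ * (a - 1) ∧ w = ρ₂ * (conj a - 1) ∧
      y * z = κ * (2 - (a + conj a)) ∧
      (1 - l₀) * (1 - l₁) * (1 - l₂) * (1 - l₃) =
        (2 - (a + conj a)) * ((1 + ρ₁) * (1 + ρ₂) - κ) ∧
      (1 + l₀) * (1 + l₁) * (1 + l₂) * (1 + l₃) =
        (2 - (a + conj a)) * ((1 - ρ₁) * (1 - ρ₂) - κ) ∧
      (l₀ * l₁ + l₂ * l₃) + (l₀ * l₂ + l₁ * l₃) + (l₀ * l₃ + l₁ * l₂) =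
        (2 - (a + conj a)) * (ρ₁ * ρ₂ - κ) - (a + conj a) ∧
      κ * (2 - (a + conj a)) * (4 - (a + conj a) ^ 2) =
        ((a + conj a) + (l₀ * l₁ + l₂ * l₃)) * ((a + conj a) + (l₀ * l₂ + l₁ * l₃)) *
          ((a + conj a) + (l₀ * l₃ + l₁ * l₂)) := by
  have hcc : conj (conj a) = a := Complex.conj_conj a
  set c := conj a with hc
  have p0 := hpoly 0
  have p1 := hpoly 1
  have pm := hpoly (-1)
  have p2 := hpoly 2
  -- Comparison of the coefficients of both sides.
  have he₄ : l₀ * l₁ * l₂ * l₃ = 1 := by linear_combination ha - p0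
  have he₁ : x + w = l₀ + l₁ + l₂ + l₃ := by
    linear_combination -(p2 - 3 * p1 - pm + 3 * p0) / 6
  have he₂ : x * w - (a + c) - y * z = l₀ * l₁ + l₀ * l₂ + l₀ * l₃ + l₁ * l₂ + l₁ * l₃ +
      l₂ * l₃ := by
    linear_combination (p1 + pm) / 2 - p0
  have he₃ : x * c + w * a = -(l₀ * l₁ * l₂ + l₀ * l₁ * l₃ + l₀ * l₂ * l₃ + l₁ * l₂ * l₃) := by
    linear_combination (p1 - pm) / 2 - (p2 - 3 * p1 - pm + 3 * p0) / 6
  have hk₀ : conj l₀ = l₁ * l₂ * l₃ := by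
    linear_combination l₁ * l₂ * l₃ * hl₀ - conj l₀ * he₄
  have hk₁ : conj l₁ = l₀ * l₂ * l₃ := by
    linear_combination l₀ * l₂ * l₃ * hl₁ - conj l₁ * he₄
  have hk₂ : conj l₂ = l₀ * l₁ * l₃ := by
    linear_combination l₀ * l₁ * l₃ * hl₂ - conj l₂ * he₄
  have hk₃ : conj l₃ = l₀ * l₁ * l₂ := by
    linear_combination l₀ * l₁ * l₂ * hl₃ - conj l₃ * he₄
  have ha1 : a - 1 ≠ 0 := by
    intro h
    have h1 : a = 1 := sub_eq_zero.1 h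
    exact ha' (by rw [hc, h1, map_one])
  have hc1 : c - 1 ≠ 0 := by
    intro h
    have h1 : c = 1 := sub_eq_zero.1 h
    rw [h1] at hcc
    exact ha1 (by rw [← hcc, map_one, sub_self])
  have hτ : 2 - (a + c) = (a - 1) * (c - 1) := by linear_combination -ha
  have hτ0 : 2 - (a + c) ≠ 0 := hτ ▸ mul_ne_zero ha1 hc1
  obtain ⟨ρ₁, rfl⟩ : ∃ ρ, x = ρ * (a - 1) := ⟨x / (a - 1), by field_simp⟩
  obtain ⟨ρ₂, rfl⟩ : ∃ ρ, w = ρ * (c - 1) := ⟨w / (c - 1), by field_simp⟩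
  have hA : ρ₁ * (1 - c) + ρ₂ * (1 - a) = -(conj l₀ + conj l₁ + conj l₂ + conj l₃) := by
    rw [hk₀, hk₁, hk₂, hk₃]
    linear_combination he₃ - (ρ₁ + ρ₂) * ha
  have hA' := congrArg conj hA
  simp only [map_add, map_mul, map_sub, map_one, map_neg, Complex.conj_conj, hcc, ← hc] at hA'
  -- The imaginary parts of `ρ₁`, `ρ₂` solve a nondegenerate homogeneous linear system.
  have hB : (ρ₁ - conj ρ₁) * (a - 1) + (ρ₂ - conj ρ₂) * (c - 1) = 0 := by
    linear_combination he₁ + hA'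
  have hB' := congrArg conj hB
  simp only [map_add, map_mul, map_sub, map_one, map_zero, Complex.conj_conj, hcc,
    ← hc] at hB'
  have hac : (a - c) ≠ 0 := sub_ne_zero.2 ha'
  have hρ₁ : conj ρ₁ = ρ₁ := by
    have : (ρ₁ - conj ρ₁) * ((a - c) * (2 - (a + c))) = 0 := by
      linear_combination (-(a - 1)) * hB - (c - 1) * hB'
    exact (sub_eq_zero.1 ((mul_eq_zero.1 this).resolve_right (mul_ne_zero hac hτ0))).symm
  have hρ₂ : conj ρ₂ = ρ₂ := by
    have : (ρ₂ - conj ρ₂) * ((a - c) * (2 - (a + c))) = 0 := by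
      linear_combination (c - 1) * hB + (a - 1) * hB'
    exact (sub_eq_zero.1 ((mul_eq_zero.1 this).resolve_right (mul_ne_zero hac hτ0))).symm
  obtain ⟨κ, hκ⟩ : ∃ κ, y * z = κ * (2 - (a + c)) := ⟨y * z / (2 - (a + c)), by field_simp⟩
  have hpair : ∀ {u v u' v' : ℂ}, u * conj u = 1 → v * conj v = 1 → u * v * u' * v' = 1 →
      conj u * conj v = u' * v' := by
    intro u v u' v' hu hv huv
    linear_combination v * conj v * u' * v' * hu + u' * v' * hv - conj u * conj v * huv
  have hκr : conj κ = κ := by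
    have h1 : (2 - (a + c)) * (ρ₁ * ρ₂ - κ) - (a + c) =
        (l₀ * l₁ + l₂ * l₃) + (l₀ * l₂ + l₁ * l₃) + (l₀ * l₃ + l₁ * l₂) := by
      linear_combination he₂ + ρ₁ * ρ₂ * hτ + hκ
    have h2 := congrArg conj h1
    simp only [map_add, map_mul, map_sub, hcc, ← hc, hρ₁, hρ₂,
      Complex.conj_ofNat] at h2
    rw [hpair hl₀ hl₁ he₄, hpair hl₂ hl₃ (u' := l₀) (v' := l₁) (by linear_combination he₄),
      hpair hl₀ hl₂ (u' := l₁) (v' := l₃) (by linear_combination he₄),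
      hpair hl₁ hl₃ (u' := l₀) (v' := l₂) (by linear_combination he₄),
      hpair hl₀ hl₃ (u' := l₁) (v' := l₂) (by linear_combination he₄),
      hpair hl₁ hl₂ (u' := l₀) (v' := l₃) (by linear_combination he₄)] at h2
    have h3 : (2 - (a + c)) * (κ - conj κ) = 0 := by linear_combination h2 - h1
    exact (sub_eq_zero.1 ((mul_eq_zero.1 h3).resolve_left hτ0)).symm
  have r₁ : ((ρ₁.re : ℝ) : ℂ) = ρ₁ := Complex.conj_eq_iff_re.1 hρ₁
  have r₂ : ((ρ₂.re : ℝ) : ℂ) = ρ₂ := Complex.conj_eq_iff_re.1 hρ₂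
  have r₃ : ((κ.re : ℝ) : ℂ) = κ := Complex.conj_eq_iff_re.1 hκr
  refine ⟨ρ₁.re, ρ₂.re, κ.re, ?_⟩
  rw [r₁, r₂, r₃]
  refine ⟨rfl, rfl, hκ, ?_, ?_, ?_, ?_⟩
  · linear_combination -p1 - hκ - (1 + ρ₁ + ρ₂ + ρ₁ * ρ₂) * hτ
  · linear_combination -pm - hκ - (1 - ρ₁ - ρ₂ + ρ₁ * ρ₂) * hτ
  · linear_combination -he₂ - hκ - ρ₁ * ρ₂ * hτ
  · have hX : ρ₁ * (a - 1) * (ρ₂ * (c - 1)) * (4 - (a + c) ^ 2) =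
        (l₀ + l₁ + l₂ + l₃) ^ 2 + (a + c) * (l₀ + l₁ + l₂ + l₃) *
          (l₀ * l₁ * l₂ + l₀ * l₁ * l₃ + l₀ * l₂ * l₃ + l₁ * l₂ * l₃) +
          (l₀ * l₁ * l₂ + l₀ * l₁ * l₃ + l₀ * l₂ * l₃ + l₁ * l₂ * l₃) ^ 2 := by
      rw [← he₁, show l₀ * l₁ * l₂ + l₀ * l₁ * l₃ + l₀ * l₂ * l₃ + l₁ * l₂ * l₃ =
        -(ρ₁ * (a - 1) * c + ρ₂ * (c - 1) * a) by rw [he₃]; ring]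
      linear_combination ((ρ₁ * (a - 1)) ^ 2 + (ρ₂ * (c - 1)) ^ 2 -
        2 * (ρ₁ * (a - 1)) * (ρ₂ * (c - 1))) * ha
    have hyz : κ * (2 - (a + c)) = ρ₁ * (a - 1) * (ρ₂ * (c - 1)) - (a + c) -
        (l₀ * l₁ + l₀ * l₂ + l₀ * l₃ + l₁ * l₂ + l₁ * l₃ + l₂ * l₃) := by
      linear_combination -hκ - he₂
    rw [hyz]
    linear_combination hX - ((l₀ + l₁ + l₂ + l₃) ^ 2 - 4 * (l₀ * l₁ + l₀ * l₂ + l₀ * l₃ +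
      l₁ * l₂ + l₁ * l₃ + l₂ * l₃) - 4 * (a + c)) * he₄

/-! ### The invariant form in the normal form -/


/-- The invariant Hermitian form on the dual space in the coordinates of the normal form: the block
matrix `[[W, R], [R, W]]` with `W = diag(1, ω)` and `R = [[ρ₁, ω q], [ω q̄, ω ρ₂]]`. -/
def dualForm (ρ₁ ρ₂ ω : ℝ) (q : ℂ) : Matrix (Fin 4) (Fin 4) ℂ :=
  !![1, 0, ρ₁, ω * q; 0, ω, ω * conj q, ω * ρ₂; ρ₁, ω * q, 1, 0; ω * conj q, ω * ρ₂, 0, ω]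

theorem dualForm_ne_zero (ρ₁ ρ₂ ω : ℝ) (q : ℂ) : dualForm ρ₁ ρ₂ ω q ≠ 0 := by
  intro h
  have := congrFun (congrFun h 0) 0
  simp [dualForm] at this

theorem dualForm_isHermitian (ρ₁ ρ₂ ω : ℝ) (q : ℂ) : (dualForm ρ₁ ρ₂ ω q).IsHermitian := by
  ext i j
  fin_cases i <;> fin_cases j <;> simp [dualForm, Matrix.conjTranspose_apply]

theorem blockSwap_mul_dualForm (ρ₁ ρ₂ ω : ℝ) (q : ℂ) :
    blockSwap * dualForm ρ₁ ρ₂ ω q * blockSwapᴴ = dualForm ρ₁ ρ₂ ω q := by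
  ext i j
  fin_cases i <;> fin_cases j <;>
    simp [dualForm, blockSwap, Matrix.mul_apply, Fin.sum_univ_four, Matrix.conjTranspose_apply]

theorem blockLower_mul_dualForm {a : ℂ} (ha : a * conj a = 1) (ρ₁ ρ₂ ω : ℝ) (q : ℂ) :
    blockLower a (conj a) (ρ₁ * (a - 1)) (q * (conj a - 1)) (ω * conj q * (a - 1))
        (ρ₂ * (conj a - 1)) * dualForm ρ₁ ρ₂ ω q *
      (blockLower a (conj a) (ρ₁ * (a - 1)) (q * (conj a - 1)) (ω * conj q * (a - 1))
        (ρ₂ * (conj a - 1)))ᴴ = dualForm ρ₁ ρ₂ ω q := by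
  have ha0 : a ≠ 0 := left_ne_zero_of_mul_eq_one ha
  -- With `conj a = a⁻¹` every entry is an identity of rational functions in `a`.
  have hc : conj a = a⁻¹ := eq_inv_of_mul_eq_one_right ha
  ext i j
  fin_cases i <;> fin_cases j <;>
    simp [dualForm, blockLower, Matrix.mul_apply, Fin.sum_univ_four,
      Matrix.conjTranspose_apply, hc] <;> field_simp <;> try ring1

/-- Completing the square in `W + R` and in `W - R` gives a congruence `dualForm = B D Bᴴ` with `D`
diagonal; the four inequalities say that the entries of `D` are positive. -/
theorem dualForm_posDef_iff_of_ne {ρ₁ ρ₂ ω : ℝ} {q : ℂ} (h₁ : 1 + ρ₁ ≠ 0) (h₂ : 1 - ρ₁ ≠ 0) :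
    (dualForm ρ₁ ρ₂ ω q).PosDef ↔ 0 < 1 + ρ₁ ∧ 0 < 1 - ρ₁ ∧
      0 < ω * (1 + ρ₂) - ω ^ 2 * Complex.normSq q / (1 + ρ₁) ∧
      0 < ω * (1 - ρ₂) - ω ^ 2 * Complex.normSq q / (1 - ρ₁) := by
  have c₁ : (1 + ρ₁ : ℂ) ≠ 0 := by exact_mod_cast h₁
  have c₂ : (1 - ρ₁ : ℂ) ≠ 0 := by exact_mod_cast h₂
  obtain ⟨s, hs⟩ : ∃ s : ℂ, (1 + ρ₁) * s = ω * conj q := ⟨ω * conj q / (1 + ρ₁), by field_simp⟩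
  obtain ⟨t, ht⟩ : ∃ t : ℂ, (1 - ρ₁) * t = -(ω * conj q) :=
    ⟨-(ω * conj q) / (1 - ρ₁), by field_simp⟩
  have hs' : (1 + ρ₁) * conj s = ω * q := by simpa using congrArg conj hs
  have ht' : (1 - ρ₁) * conj t = -(ω * q) := by simpa using congrArg conj ht
  have hn : ∀ u : ℂ, ((Complex.normSq u : ℝ) : ℂ) = u * conj u :=
    fun u => (Complex.mul_conj u).symm
  have ns : ω ^ 2 * Complex.normSq q / (1 + ρ₁) = (1 + ρ₁) * Complex.normSq s := by
    rw [div_eq_iff h₁]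
    have : ((ω ^ 2 * Complex.normSq q : ℝ) : ℂ) =
        (((1 + ρ₁) * Complex.normSq s * (1 + ρ₁) : ℝ) : ℂ) := by
      push_cast
      rw [hn, hn]
      linear_combination -(1 + ρ₁) * s * hs' - ω * q * hs
    exact_mod_cast this
  have nt : ω ^ 2 * Complex.normSq q / (1 - ρ₁) = (1 - ρ₁) * Complex.normSq t := by
    rw [div_eq_iff h₂]
    have : ((ω ^ 2 * Complex.normSq q : ℝ) : ℂ) =
        (((1 - ρ₁) * Complex.normSq t * (1 - ρ₁) : ℝ) : ℂ) := by
      push_cast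
      rw [hn, hn]
      linear_combination -(1 - ρ₁) * t * ht' + ω * q * ht
    exact_mod_cast this
  rw [ns, nt]
  let B : Matrix (Fin 4) (Fin 4) ℂ := !![1, 0, 1, 0; s, 1, t, 1; 1, 0, -1, 0; s, 1, -t, -1]
  let d : Fin 4 → ℝ := ![(1 + ρ₁) / 2,
    (ω * (1 + ρ₂) - (1 + ρ₁) * Complex.normSq s) / 2, (1 - ρ₁) / 2,
    (ω * (1 - ρ₂) - (1 - ρ₁) * Complex.normSq t) / 2]
  have hB : IsUnit B := by
    rw [Matrix.isUnit_iff_isUnit_det]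
    refine Ne.isUnit ?_
    have : B.det = 4 := by
      simp [B, Matrix.det_succ_row_zero, Fin.sum_univ_succ, Fin.succAbove]
      ring
    rw [this]
    norm_num
  have hBD : B * Matrix.diagonal (fun i => (d i : ℂ)) * star B = dualForm ρ₁ ρ₂ ω q := by
    rw [Matrix.star_eq_conjTranspose]
    ext i j
    rw [Matrix.mul_apply, Fin.sum_univ_four]
    simp only [Matrix.mul_diagonal, Matrix.conjTranspose_apply]
    fin_cases i <;> fin_cases j <;> simp [dualForm, B, d, hn] <;> first
      | ring1
      | linear_combination (hs + ht) / 2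
      | linear_combination (hs - ht) / 2
      | linear_combination (hs' + ht') / 2
      | linear_combination (hs' - ht') / 2
  rw [← hBD, Matrix.IsUnit.posDef_star_right_conjugate_iff hB, Matrix.posDef_diagonal_iff]
  simp only [Complex.zero_lt_real, d]
  constructor
  · intro h
    have g0 := h 0
    have g1 := h 1
    have g2 := h 2
    have g3 := h 3
    simp at g0 g1 g2 g3
    exact ⟨g0, by linarith, by linarith, by linarith⟩
  · rintro ⟨g0, g1, g2, g3⟩ i
    fin_cases i <;> simp <;> linarith

theorem dualForm_isDefiniteForm_iff {ρ₁ ρ₂ ω κ : ℝ} {q : ℂ} (hq : q ≠ 0)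
    (hκ : κ = ω * Complex.normSq q) :
    IsDefiniteForm (dualForm ρ₁ ρ₂ ω q) ↔ 0 < κ ∧ 0 < 1 + ρ₁ ∧ 0 < 1 - ρ₁ ∧
      κ < (1 + ρ₁) * (1 + ρ₂) ∧ κ < (1 - ρ₁) * (1 - ρ₂) := by
  have hn : 0 < Complex.normSq q := Complex.normSq_pos.2 hq
  have hκ0 : 0 < κ ↔ 0 < ω := by rw [hκ]; exact mul_pos_iff_of_pos_right hn
  have key : ∀ {s t : ℝ}, 0 < s → 0 < ω →
      (0 < ω * t - ω ^ 2 * Complex.normSq q / s ↔ κ < s * t) := by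
    intro s t hs hω
    have : ω * t - ω ^ 2 * Complex.normSq q / s = ω / s * (s * t - κ) := by
      rw [hκ]; field_simp
    rw [this, mul_pos_iff_of_pos_left (div_pos hω hs), sub_pos]
  constructor
  · intro h
    have h : (dualForm ρ₁ ρ₂ ω q).PosDef := by
      refine h.resolve_right fun hneg => ?_
      have := hneg.diag_pos (i := 0)
      have h1 : (-dualForm ρ₁ ρ₂ ω q) 0 0 = ((-1 : ℝ) : ℂ) := by simp [dualForm]
      rw [h1, Complex.zero_lt_real] at this
      linarith
    have hω : 0 < ω := by
      have := h.diag_pos (i := 1)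
      have h1 : dualForm ρ₁ ρ₂ ω q 1 1 = (ω : ℂ) := by simp [dualForm]
      rwa [h1, Complex.zero_lt_real] at this
    -- The values of the form at `(1, 0, ±1, 0)` are `2 (1 ± ρ₁)`.
    have hv : ∀ e : ℝ, e * e = 1 → 0 < 1 + e * ρ₁ := by
      intro e he
      have h0 : (![1, 0, (e : ℂ), 0] : Fin 4 → ℂ) ≠ 0 := fun h' => by
        have := congrFun h' 0
        simp at this
      have h1 := h.dotProduct_mulVec_pos h0
      have h2 : star (![1, 0, (e : ℂ), 0] : Fin 4 → ℂ) ⬝ᵥ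
          dualForm ρ₁ ρ₂ ω q *ᵥ ![1, 0, (e : ℂ), 0] = ((2 * (1 + e * ρ₁) : ℝ) : ℂ) := by
        have he' : (e : ℂ) * e = 1 := by exact_mod_cast he
        simp [dualForm, Matrix.mulVec, dotProduct, Fin.sum_univ_four]
        linear_combination he'
      rw [h2, Complex.zero_lt_real] at h1
      linarith
    have hp : 0 < 1 + ρ₁ := by simpa using hv 1 (by norm_num)
    have hm : 0 < 1 - ρ₁ := by simpa [sub_eq_add_neg] using hv (-1) (by norm_num)
    obtain ⟨-, -, g1, g2⟩ := (dualForm_posDef_iff_of_ne hp.ne' hm.ne').1 h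
    exact ⟨hκ0.2 hω, hp, hm, (key hp hω).1 g1, (key hm hω).1 g2⟩
  · rintro ⟨hk, hp, hm, g1, g2⟩
    have hω := hκ0.1 hk
    exact Or.inl ((dualForm_posDef_iff_of_ne hp.ne' hm.ne').2
      ⟨hp, hm, (key hp hω).2 g1, (key hm hω).2 g2⟩)

/-! ### The numerical criterion -/

theorem circleExp_add (x y : ℝ) : circleExp (x + y) = circleExp x * circleExp y := by
  simp only [circleExp, ← Complex.exp_add]
  push_cast
  ring_nf

theorem circleExp_neg (x : ℝ) : circleExp (-x) = (circleExp x)⁻¹ := by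
  simp only [circleExp, ← Complex.exp_neg]
  push_cast
  ring_nf

theorem circleExp_ne_zero (x : ℝ) : circleExp x ≠ 0 := Complex.exp_ne_zero _

theorem circleExp_intCast (n : ℤ) : circleExp n = 1 := by
  rw [circleExp, Complex.exp_eq_one_iff]
  exact ⟨n, by push_cast; ring⟩

theorem exists_int_of_circleExp_eq_one {x : ℝ} (h : circleExp x = 1) : ∃ n : ℤ, x = n := by
  rw [circleExp, Complex.exp_eq_one_iff] at h
  obtain ⟨n, hn⟩ := h
  refine ⟨n, ?_⟩
  have h2 : (2 * (Real.pi : ℂ) * Complex.I) ≠ 0 := by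
    simp [Real.pi_ne_zero]
  have h3 : (x : ℂ) = (n : ℂ) := mul_left_cancel₀ h2 (by rw [hn]; ring)
  exact_mod_cast h3

theorem circleExp_eq_cos_add_sin (x : ℝ) : circleExp x =
    (Real.cos (2 * Real.pi * x) : ℝ) + (Real.sin (2 * Real.pi * x) : ℝ) * Complex.I := by
  rw [circleExp, Complex.ofReal_cos, Complex.ofReal_sin, ← Complex.exp_mul_I]
  congr 1
  push_cast
  ring

theorem conj_circleExp (x : ℝ) : (starRingEnd ℂ) (circleExp x) = circleExp (-x) := by
  rw [circleExp_eq_cos_add_sin, circleExp_eq_cos_add_sin]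
  simp [-Complex.ofReal_cos, -Complex.ofReal_sin]

theorem circleExp_add_neg (x : ℝ) :
    circleExp x + circleExp (-x) = ((2 * Real.cos (2 * Real.pi * x) : ℝ) : ℂ) := by
  rw [circleExp_eq_cos_add_sin, circleExp_eq_cos_add_sin]
  simp [-Complex.ofReal_cos, -Complex.ofReal_sin]
  ring

theorem one_sub_circleExp_neg (x : ℝ) : 1 - circleExp (-x) =
    2 * Complex.I * (Real.sin (Real.pi * x) : ℝ) * circleExp (-(x / 2)) := by
  rw [circleExp_eq_cos_add_sin, circleExp_eq_cos_add_sin,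
    show 2 * Real.pi * (-x) = -(2 * (Real.pi * x)) by ring,
    show 2 * Real.pi * (-(x / 2)) = -(Real.pi * x) by ring,
    Real.cos_neg, Real.sin_neg, Real.cos_neg, Real.sin_neg, Real.cos_two_mul', Real.sin_two_mul]
  have h : ((Real.sin (Real.pi * x) : ℝ) : ℂ) ^ 2 + ((Real.cos (Real.pi * x) : ℝ) : ℂ) ^ 2 = 1 := by
    exact_mod_cast Real.sin_sq_add_cos_sq (Real.pi * x)
  push_cast [-Complex.ofReal_cos, -Complex.ofReal_sin]
  linear_combination (-1) * h + 2 * ((Real.sin (Real.pi * x) : ℝ) : ℂ) ^ 2 * Complex.I_sq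

theorem one_add_circleExp_neg (x : ℝ) : 1 + circleExp (-x) =
    2 * (Real.cos (Real.pi * x) : ℝ) * circleExp (-(x / 2)) := by
  rw [circleExp_eq_cos_add_sin, circleExp_eq_cos_add_sin,
    show 2 * Real.pi * (-x) = -(2 * (Real.pi * x)) by ring,
    show 2 * Real.pi * (-(x / 2)) = -(Real.pi * x) by ring,
    Real.cos_neg, Real.sin_neg, Real.cos_neg, Real.sin_neg, Real.cos_two_mul', Real.sin_two_mul]
  have h : ((Real.sin (Real.pi * x) : ℝ) : ℂ) ^ 2 + ((Real.cos (Real.pi * x) : ℝ) : ℂ) ^ 2 = 1 := by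
    exact_mod_cast Real.sin_sq_add_cos_sq (Real.pi * x)
  push_cast [-Complex.ofReal_cos, -Complex.ofReal_sin]
  linear_combination (-1) * h

theorem circleExp_neg_half_int {x : ℝ} {N : ℤ} (h : x = N) :
    circleExp (-(x / 2)) = (Real.cos (Real.pi * N) : ℝ) := by
  rw [circleExp_eq_cos_add_sin, show 2 * Real.pi * (-(x / 2)) = -(Real.pi * N) by rw [h]; ring,
    Real.cos_neg, Real.sin_neg, mul_comm Real.pi, Real.sin_int_mul_pi]
  simp

theorem prod_one_sub_circleExp_neg {x₀ x₁ x₂ x₃ : ℝ} {N : ℤ} (h : x₀ + x₁ + x₂ + x₃ = N) :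
    (1 - circleExp (-x₀)) * (1 - circleExp (-x₁)) * (1 - circleExp (-x₂)) *
      (1 - circleExp (-x₃)) = ((16 * (Real.sin (Real.pi * x₀) * Real.sin (Real.pi * x₁) *
        Real.sin (Real.pi * x₂) * Real.sin (Real.pi * x₃)) * Real.cos (Real.pi * N) : ℝ) : ℂ) := by
  have h1 := circleExp_neg_half_int h
  rw [show -((x₀ + x₁ + x₂ + x₃) / 2) = -(x₀ / 2) + -(x₁ / 2) + -(x₂ / 2) + -(x₃ / 2) by ring,
    circleExp_add, circleExp_add, circleExp_add] at h1
  simp only [one_sub_circleExp_neg]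
  rw [Complex.ofReal_mul _ (Real.cos _), ← h1]
  push_cast [-Complex.ofReal_cos, -Complex.ofReal_sin]
  have hI : Complex.I ^ 4 = 1 := Complex.I_pow_four
  linear_combination (16 * ((Real.sin (Real.pi * x₀) : ℝ) : ℂ) * (Real.sin (Real.pi * x₁) : ℝ) *
    (Real.sin (Real.pi * x₂) : ℝ) * (Real.sin (Real.pi * x₃) : ℝ) * circleExp (-(x₀ / 2)) *
    circleExp (-(x₁ / 2)) * circleExp (-(x₂ / 2)) * circleExp (-(x₃ / 2))) * hI

theorem prod_one_add_circleExp_neg {x₀ x₁ x₂ x₃ : ℝ} {N : ℤ} (h : x₀ + x₁ + x₂ + x₃ = N) :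
    (1 + circleExp (-x₀)) * (1 + circleExp (-x₁)) * (1 + circleExp (-x₂)) *
      (1 + circleExp (-x₃)) = ((16 * (Real.cos (Real.pi * x₀) * Real.cos (Real.pi * x₁) *
        Real.cos (Real.pi * x₂) * Real.cos (Real.pi * x₃)) * Real.cos (Real.pi * N) : ℝ) : ℂ) := by
  have h1 := circleExp_neg_half_int h
  rw [show -((x₀ + x₁ + x₂ + x₃) / 2) = -(x₀ / 2) + -(x₁ / 2) + -(x₂ / 2) + -(x₃ / 2) by ring,
    circleExp_add, circleExp_add, circleExp_add] at h1
  simp only [one_add_circleExp_neg]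
  rw [Complex.ofReal_mul _ (Real.cos (Real.pi * N)), ← h1]
  push_cast [-Complex.ofReal_cos, -Complex.ofReal_sin]
  ring

theorem fract_mem_Ioo_iff_cos {α : ℝ} (hα : α ∈ Set.Ioo (0 : ℝ) (1 / 2)) (x : ℝ) :
    Int.fract x ∈ Set.Ioo (1 / 2 - α) (1 / 2 + α) ↔
      2 * Real.cos (2 * Real.pi * α) + 2 * Real.cos (2 * Real.pi * x) < 0 := by
  obtain ⟨h0, h1⟩ := hα
  have hπ := Real.pi_pos
  have hf0 := Int.fract_nonneg x
  have hf1 := Int.fract_lt_one x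
  have hx : Real.cos (2 * Real.pi * x) = Real.cos (2 * Real.pi * Int.fract x) := by
    conv_lhs => rw [← Int.floor_add_fract x]
    rw [show 2 * Real.pi * ((⌊x⌋ : ℝ) + Int.fract x) =
      2 * Real.pi * Int.fract x + ⌊x⌋ * (2 * Real.pi) by ring, Real.cos_add_int_mul_two_pi]
  have hα' : Real.cos (2 * Real.pi * α) = -Real.cos (2 * Real.pi * (1 / 2 - α)) := by
    rw [show 2 * Real.pi * (1 / 2 - α) = Real.pi - 2 * Real.pi * α by ring, Real.cos_pi_sub,
      neg_neg]
  have key : ∀ f : ℝ, 0 ≤ f → f ≤ 1 / 2 →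
      (1 / 2 - α < f ↔ Real.cos (2 * Real.pi * f) < Real.cos (2 * Real.pi * (1 / 2 - α))) := by
    intro f hf hf'
    rw [Real.strictAntiOn_cos.lt_iff_gt (a := 2 * Real.pi * f) (b := 2 * Real.pi * (1 / 2 - α))
      ⟨by positivity, by nlinarith⟩ ⟨by nlinarith, by nlinarith⟩]
    exact (mul_lt_mul_iff_right₀ (by positivity)).symm
  rw [hx, hα']
  rcases le_total (Int.fract x) (1 / 2) with hf | hf
  · have := key _ hf0 hf
    constructor
    · rintro ⟨ha, -⟩
      linarith [this.1 ha]
    · intro h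
      exact ⟨this.2 (by linarith), by linarith⟩
  · have := key (1 - Int.fract x) (by linarith) (by linarith)
    rw [show 2 * Real.pi * (1 - Int.fract x) = 2 * Real.pi - 2 * Real.pi * Int.fract x by ring,
      Real.cos_two_pi_sub] at this
    constructor
    · rintro ⟨-, ha⟩
      linarith [this.1 (by linarith)]
    · intro h
      exact ⟨by linarith, by linarith [this.2 (by linarith)]⟩

open Classical in
theorem countHalf_eq {γ : Fin 4 → ℝ} (hγ : ∀ i, γ i ∈ Set.Ioo (0 : ℝ) 1) :
    countHalf γ = (if γ 0 < 1 / 2 then 1 else 0) + (if γ 1 < 1 / 2 then 1 else 0) +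
      (if γ 2 < 1 / 2 then 1 else 0) + (if γ 3 < 1 / 2 then 1 else 0) := by
  have h : {i : Fin 4 | γ i ∈ Set.Ioo (0 : ℝ) (1 / 2)} =
      ((Finset.univ.filter fun i => γ i < 1 / 2 : Finset (Fin 4)) : Set (Fin 4)) := by
    ext i
    simp [(hγ i).1]
  rw [countHalf, h, Set.ncard_coe_finset, Finset.card_filter, Fin.sum_univ_four]

theorem cos_two_pi_complement {x y : ℝ} {N : ℤ} (h : x + y = N) :
    Real.cos (2 * Real.pi * y) = Real.cos (2 * Real.pi * x) := by
  rw [show 2 * Real.pi * y = N * (2 * Real.pi) - 2 * Real.pi * x by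
    rw [← h]; ring, Real.cos_int_mul_two_pi_sub]

open Classical in
/-- Complementary pairs count together, because the four exponents add up to an integer. -/
theorem countPairs_eq {α : ℝ} (hα : α ∈ Set.Ioo (0 : ℝ) (1 / 2)) {γ : Fin 4 → ℝ} {N : ℤ}
    (hN : γ 0 + γ 1 + γ 2 + γ 3 = N) :
    countPairs α γ =
      2 * ((if 2 * Real.cos (2 * Real.pi * α) + 2 * Real.cos (2 * Real.pi * (γ 0 + γ 1)) < 0
          then 1 else 0) +
        (if 2 * Real.cos (2 * Real.pi * α) + 2 * Real.cos (2 * Real.pi * (γ 0 + γ 2)) < 0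
          then 1 else 0) +
        (if 2 * Real.cos (2 * Real.pi * α) + 2 * Real.cos (2 * Real.pi * (γ 0 + γ 3)) < 0
          then 1 else 0)) := by
  have h : {p : Fin 4 × Fin 4 | p.1 < p.2 ∧
      Int.fract (γ p.1 + γ p.2) ∈ Set.Ioo (1 / 2 - α) (1 / 2 + α)} =
      ((Finset.univ.filter fun p : Fin 4 × Fin 4 => p.1 < p.2 ∧
        2 * Real.cos (2 * Real.pi * α) + 2 * Real.cos (2 * Real.pi * (γ p.1 + γ p.2)) < 0 :
        Finset (Fin 4 × Fin 4)) : Set (Fin 4 × Fin 4)) := by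
    ext p
    simp only [Set.mem_ofPred_eq, Finset.coe_filter, Finset.mem_univ, true_and,
      fract_mem_Ioo_iff_cos hα]
  have e23 := cos_two_pi_complement (x := γ 0 + γ 1) (y := γ 2 + γ 3) (N := N) (by linarith)
  have e13 := cos_two_pi_complement (x := γ 0 + γ 2) (y := γ 1 + γ 3) (N := N) (by linarith)
  have e12 := cos_two_pi_complement (x := γ 0 + γ 3) (y := γ 1 + γ 2) (N := N) (by linarith)
  rw [countPairs, h, Set.ncard_coe_finset, Finset.card_filter, Fintype.sum_prod_type]
  simp only [Fin.sum_univ_four, e23, e13, e12, lt_self_iff_false, false_and, if_false,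
    show (0 : Fin 4) < 1 by decide, show (0 : Fin 4) < 2 by decide,
    show (0 : Fin 4) < 3 by decide, show (1 : Fin 4) < 2 by decide,
    show (1 : Fin 4) < 3 by decide, show (2 : Fin 4) < 3 by decide,
    show ¬ (1 : Fin 4) < 0 by decide, show ¬ (2 : Fin 4) < 0 by decide,
    show ¬ (3 : Fin 4) < 0 by decide, show ¬ (2 : Fin 4) < 1 by decide,
    show ¬ (3 : Fin 4) < 1 by decide, show ¬ (3 : Fin 4) < 2 by decide, true_and]
  ring

/-- With `a, b` in the upper and `c, d` in the lower half of the circle,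
`cos π(a - b)` and `cos π(c - d)` are both at least `|cos π(a + b)| = |cos π(c + d)|`. -/
theorem one_add_cos_le_cos_add_cos {a b c d : ℝ} (ha : a ∈ Set.Ioo (0 : ℝ) (1 / 2))
    (hb : b ∈ Set.Ioo (0 : ℝ) (1 / 2)) (hc : c ∈ Set.Ico (1 / 2 : ℝ) 1)
    (hd : d ∈ Set.Ico (1 / 2 : ℝ) 1) (h : a + b + c + d = 2) :
    1 + Real.cos (2 * Real.pi * (a + b)) ≤
      Real.cos (2 * Real.pi * (a + c)) + Real.cos (2 * Real.pi * (a + d)) := by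
  have hπ := Real.pi_pos
  have sinpos : ∀ x : ℝ, 0 < x → x < 1 → 0 < Real.sin (Real.pi * x) := fun x h0 h1 =>
    Real.sin_pos_of_pos_of_lt_pi (by positivity) (by nlinarith)
  have cospos : ∀ x : ℝ, 0 < x → x < 1 / 2 → 0 < Real.cos (Real.pi * x) := fun x h0 h1 =>
    Real.cos_pos_of_mem_Ioo ⟨by nlinarith, by nlinarith⟩
  have cosneg : ∀ x : ℝ, 1 / 2 ≤ x → x < 1 → Real.cos (Real.pi * x) ≤ 0 := fun x h0 h1 =>
    Real.cos_nonpos_of_pi_div_two_le_of_le (by nlinarith) (by nlinarith)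
  have s1 := mul_pos (sinpos a ha.1 (by linarith [ha.2])) (sinpos b hb.1 (by linarith [hb.2]))
  have s2 := mul_pos (cospos a ha.1 ha.2) (cospos b hb.1 hb.2)
  have s3 := mul_pos (sinpos c (by linarith [hc.1]) hc.2) (sinpos d (by linarith [hd.1]) hd.2)
  have s4 := mul_nonneg_of_nonpos_of_nonpos (cosneg c hc.1 hc.2) (cosneg d hd.1 hd.2)
  have e1 : Real.cos (Real.pi * (a + b)) = Real.cos (Real.pi * a) * Real.cos (Real.pi * b) -
      Real.sin (Real.pi * a) * Real.sin (Real.pi * b) := by rw [mul_add, Real.cos_add]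
  have e2 : Real.cos (Real.pi * (a + b)) = Real.cos (Real.pi * c) * Real.cos (Real.pi * d) -
      Real.sin (Real.pi * c) * Real.sin (Real.pi * d) := by
    rw [← Real.cos_add, show Real.pi * (a + b) = 2 * Real.pi - (Real.pi * c + Real.pi * d) by
      linear_combination Real.pi * h, Real.cos_two_pi_sub]
  have e3 : Real.cos (2 * Real.pi * (a + c)) + Real.cos (2 * Real.pi * (a + d)) =
      2 * ((Real.cos (Real.pi * a) * Real.cos (Real.pi * b) +
        Real.sin (Real.pi * a) * Real.sin (Real.pi * b)) *
        (Real.cos (Real.pi * c) * Real.cos (Real.pi * d) +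
        Real.sin (Real.pi * c) * Real.sin (Real.pi * d))) := by
    rw [Real.cos_add_cos, ← Real.cos_sub, ← Real.cos_sub,
      show (2 * Real.pi * (a + c) + 2 * Real.pi * (a + d)) / 2 =
        Real.pi * a - Real.pi * b + 2 * Real.pi by linear_combination Real.pi * h,
      show (2 * Real.pi * (a + c) - 2 * Real.pi * (a + d)) / 2 = Real.pi * c - Real.pi * d by ring,
      Real.cos_add_two_pi]
    ring
  have e4 : 1 + Real.cos (2 * Real.pi * (a + b)) = 2 * Real.cos (Real.pi * (a + b)) ^ 2 := by
    rw [show 2 * Real.pi * (a + b) = 2 * (Real.pi * (a + b)) by ring, Real.cos_two_mul]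
    ring
  rw [e3, e4]
  have m1 : |Real.cos (Real.pi * (a + b))| ≤ Real.cos (Real.pi * a) * Real.cos (Real.pi * b) +
      Real.sin (Real.pi * a) * Real.sin (Real.pi * b) := by
    rw [abs_le]; constructor <;> linarith
  have m2 : |Real.cos (Real.pi * (a + b))| ≤ Real.cos (Real.pi * c) * Real.cos (Real.pi * d) +
      Real.sin (Real.pi * c) * Real.sin (Real.pi * d) := by
    rw [abs_le]; constructor <;> linarith
  have m3 := mul_le_mul m1 m2 (abs_nonneg _) ((abs_nonneg _).trans m1)
  rw [← abs_mul, ← pow_two, abs_of_nonneg (sq_nonneg _)] at m3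
  linarith

open Classical in
theorem two_mul_count_neg_eq_four {A B C : ℝ} (h : 0 < A * B * C)
    (h' : A < 0 ∨ B < 0 ∨ C < 0) :
    2 * ((if A < 0 then 1 else 0) + (if B < 0 then 1 else 0) + (if C < 0 then 1 else 0)) = 4 := by
  simp only [mul_pos_iff, mul_neg_iff] at h
  rcases h with ⟨⟨hA, hB⟩ | ⟨hA, hB⟩, hC⟩ | ⟨⟨hA, hB⟩ | ⟨hA, hB⟩, hC⟩
  · rcases h' with h' | h' | h' <;> linarith
  · simp [hA, hB, not_lt.2 hC.le]
  · simp [not_lt.2 hA.le, hB, hC]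
  · simp [hA, not_lt.2 hB.le, hC]

open Classical in
theorem pos_of_two_mul_count_neg_eq_four {A B C : ℝ} (h : A * B * C ≠ 0)
    (h' : 2 * ((if A < 0 then 1 else 0) + (if B < 0 then 1 else 0) +
      (if C < 0 then 1 else 0)) = 4) :
    0 < A * B * C ∧ (A + B < 0 ∨ A + C < 0 ∨ B + C < 0) := by
  have hC : C ≠ 0 := right_ne_zero_of_mul h
  have hB : B ≠ 0 := right_ne_zero_of_mul (left_ne_zero_of_mul h)
  have hA : A ≠ 0 := left_ne_zero_of_mul (left_ne_zero_of_mul h)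
  rcases lt_or_gt_of_ne hA with a | a <;> rcases lt_or_gt_of_ne hB with b | b <;>
    rcases lt_or_gt_of_ne hC with c | c <;>
    simp only [a, b, c, not_lt_of_gt a, not_lt_of_gt b, not_lt_of_gt c, if_true, if_false] at h' <;>
    first
    | omega
    | exact ⟨mul_pos (mul_pos_of_neg_of_neg a b) c, Or.inl (add_neg a b)⟩
    | exact ⟨mul_pos_of_neg_of_neg (mul_neg_of_neg_of_pos a b) c, Or.inr (Or.inl (add_neg a c))⟩
    | exact ⟨mul_pos_of_neg_of_neg (mul_neg_of_pos_of_neg a b) c, Or.inr (Or.inr (add_neg b c))⟩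

open Classical in
/-- If exactly two exponents are smaller than `1/2`, the sum of the exponents lies strictly between
`1` and `3`. The function `g` stands for `cos (π γᵢ)`, which is positive for `γᵢ < 1/2` and
nonpositive otherwise; the product of its values is nonnegative. -/
theorem bounds_of_count_half_eq_two {γ : Fin 4 → ℝ} (hγ : ∀ i, γ i ∈ Set.Ioo (0 : ℝ) 1)
    {g : Fin 4 → ℝ} (h₁ : ∀ i, γ i < 1 / 2 → 0 < g i) (h₂ : ∀ i, 1 / 2 ≤ γ i → g i ≤ 0)
    (h : (if γ 0 < 1 / 2 then 1 else 0) + (if γ 1 < 1 / 2 then 1 else 0) +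
      (if γ 2 < 1 / 2 then 1 else 0) + (if γ 3 < 1 / 2 then 1 else 0) = 2) :
    1 < γ 0 + γ 1 + γ 2 + γ 3 ∧ γ 0 + γ 1 + γ 2 + γ 3 < 3 ∧ 0 ≤ g 0 * g 1 * g 2 * g 3 := by
  have main : ∀ i j k l : Fin 4, γ 0 + γ 1 + γ 2 + γ 3 = γ i + γ j + γ k + γ l →
      g 0 * g 1 * g 2 * g 3 = g i * g j * (g k * g l) →
      γ i < 1 / 2 → γ j < 1 / 2 → 1 / 2 ≤ γ k → 1 / 2 ≤ γ l →
      1 < γ 0 + γ 1 + γ 2 + γ 3 ∧ γ 0 + γ 1 + γ 2 + γ 3 < 3 ∧ 0 ≤ g 0 * g 1 * g 2 * g 3 := by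
    intro i j k l hs hg hi hj hk hl
    have gi := hγ i
    have gj := hγ j
    have gk := hγ k
    have gl := hγ l
    simp only [Set.mem_Ioo] at gi gj gk gl
    rw [hs, hg]
    exact ⟨by linarith, by linarith, mul_nonneg (mul_nonneg (h₁ i hi).le (h₁ j hj).le)
      (mul_nonneg_of_nonpos_of_nonpos (h₂ k hk) (h₂ l hl))⟩
  rcases lt_or_ge (γ 0) (1 / 2) with t0 | t0 <;> rcases lt_or_ge (γ 1) (1 / 2) with t1 | t1 <;>
    rcases lt_or_ge (γ 2) (1 / 2) with t2 | t2 <;> rcases lt_or_ge (γ 3) (1 / 2) with t3 | t3 <;>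
    simp only [t0, t1, t2, t3, not_lt.2, if_true, if_false] at h <;> first
    | omega
    | exact main 0 1 2 3 (by ring) (by ring) t0 t1 t2 t3
    | exact main 0 2 1 3 (by ring) (by ring) t0 t2 t1 t3
    | exact main 0 3 1 2 (by ring) (by ring) t0 t3 t1 t2
    | exact main 1 2 0 3 (by ring) (by ring) t1 t2 t0 t3
    | exact main 1 3 0 2 (by ring) (by ring) t1 t3 t0 t2
    | exact main 2 3 0 1 (by ring) (by ring) t2 t3 t0 t1

open Classical in
/-- The counts forced by positivity. The sum of the exponents and the sign of the product of the
cosines put two exponents `a, b` below `1/2`; `one_add_cos_le_cos_add_cos` then shows that the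
factor of the pair `a, b` is negative. -/
theorem counts_of_cos_pos {γ : Fin 4 → ℝ} (hγ : ∀ i, γ i ∈ Set.Ioo (0 : ℝ) 1)
    (hs : γ 0 + γ 1 + γ 2 + γ 3 = 2)
    (hcospos : 0 < Real.cos (Real.pi * γ 0) * Real.cos (Real.pi * γ 1) *
      Real.cos (Real.pi * γ 2) * Real.cos (Real.pi * γ 3))
    {T y₁ y₂ y₃ : ℝ} (hy₁ : y₁ = 2 * Real.cos (2 * Real.pi * (γ 0 + γ 1)))
    (hy₂ : y₂ = 2 * Real.cos (2 * Real.pi * (γ 0 + γ 2)))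
    (hy₃ : y₃ = 2 * Real.cos (2 * Real.pi * (γ 0 + γ 3)))
    (hdet : y₁ + y₂ + y₃ < 2 - 2 * T) (hprod : 0 < (T + y₁) * (T + y₂) * (T + y₃)) :
    (if γ 0 < 1 / 2 then 1 else 0) + (if γ 1 < 1 / 2 then 1 else 0) +
      (if γ 2 < 1 / 2 then 1 else 0) + (if γ 3 < 1 / 2 then 1 else 0) = 2 ∧
    2 * ((if T + y₁ < 0 then 1 else 0) + (if T + y₂ < 0 then 1 else 0) +
      (if T + y₃ < 0 then 1 else 0)) = 4 := by
  have hπ := Real.pi_pos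
  have hcos2 : ∀ i, 1 / 2 ≤ γ i → Real.cos (Real.pi * γ i) ≤ 0 := fun i hi =>
    Real.cos_nonpos_of_pi_div_two_le_of_le (by nlinarith) (by nlinarith [(hγ i).2])
  have g0 := hγ 0
  have g1 := hγ 1
  have g2 := hγ 2
  have g3 := hγ 3
  simp only [Set.mem_Ioo] at g0 g1 g2 g3
  have lt_half : ∀ i, 0 < Real.cos (Real.pi * γ i) → γ i < 1 / 2 := fun i hi => by
    by_contra hcon
    linarith [hcos2 i (not_lt.1 hcon)]
  have half_lt : ∀ i, Real.cos (Real.pi * γ i) < 0 → 1 / 2 < γ i := fun i hi => by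
    by_contra hcon
    linarith [Real.cos_nonneg_of_mem_Icc (x := Real.pi * γ i)
      ⟨by nlinarith [(hγ i).1], by nlinarith [not_lt.1 hcon]⟩]
  have hcount : ∀ i j k l : Fin 4, γ i < 1 / 2 → γ j < 1 / 2 → 1 / 2 ≤ γ k → 1 / 2 ≤ γ l →
      γ i + γ j + γ k + γ l = 2 → 1 + Real.cos (2 * Real.pi * (γ i + γ j)) ≤
      Real.cos (2 * Real.pi * (γ i + γ k)) + Real.cos (2 * Real.pi * (γ i + γ l)) :=
    fun i j k l hi hj hk hl h => one_add_cos_le_cos_add_cos ⟨(hγ i).1, hi⟩ ⟨(hγ j).1, hj⟩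
      ⟨hk, (hγ k).2⟩ ⟨hl, (hγ l).2⟩ h
  have e23 := cos_two_pi_complement (x := γ 0 + γ 1) (y := γ 2 + γ 3) (N := 2)
    (by push_cast; linarith)
  have e13 := cos_two_pi_complement (x := γ 0 + γ 2) (y := γ 1 + γ 3) (N := 2)
    (by push_cast; linarith)
  have e12 := cos_two_pi_complement (x := γ 0 + γ 3) (y := γ 1 + γ 2) (N := 2)
    (by push_cast; linarith)
  -- An even number of cosines is negative; the sum of the exponents excludes zero and four.
  simp only [mul_pos_iff, mul_neg_iff] at hcospos
  rcases hcospos with ⟨⟨⟨s0, s1⟩ | ⟨s0, s1⟩, s2⟩ | ⟨⟨s0, s1⟩ | ⟨s0, s1⟩, s2⟩, s3⟩ |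
    ⟨⟨⟨s0, s1⟩ | ⟨s0, s1⟩, s2⟩ | ⟨⟨s0, s1⟩ | ⟨s0, s1⟩, s2⟩, s3⟩
  · linarith [lt_half 0 s0, lt_half 1 s1, lt_half 2 s2, lt_half 3 s3]
  · have t0 := (half_lt 0 s0).le
    have t1 := (half_lt 1 s1).le
    have t2 := lt_half 2 s2
    have t3 := lt_half 3 s3
    have h8 := hcount 2 3 0 1 t2 t3 t0 t1 (by linarith)
    rw [add_comm (γ 2) (γ 0), add_comm (γ 2) (γ 1)] at h8
    exact ⟨by simp only [t2, t3, not_lt.2 t0, not_lt.2 t1, if_true, if_false],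
      two_mul_count_neg_eq_four hprod (Or.inl (by linarith))⟩
  · have t0 := lt_half 0 s0
    have t1 := (half_lt 1 s1).le
    have t2 := (half_lt 2 s2).le
    have t3 := lt_half 3 s3
    have h8 := hcount 0 3 1 2 t0 t3 t1 t2 (by linarith)
    exact ⟨by simp only [t0, t3, not_lt.2 t1, not_lt.2 t2, if_true, if_false],
      two_mul_count_neg_eq_four hprod (Or.inr (Or.inr (by linarith)))⟩
  · have t0 := (half_lt 0 s0).le
    have t1 := lt_half 1 s1
    have t2 := (half_lt 2 s2).le
    have t3 := lt_half 3 s3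
    have h8 := hcount 1 3 0 2 t1 t3 t0 t2 (by linarith)
    rw [add_comm (γ 1) (γ 0)] at h8
    exact ⟨by simp only [t1, t3, not_lt.2 t0, not_lt.2 t2, if_true, if_false],
      two_mul_count_neg_eq_four hprod (Or.inr (Or.inl (by linarith)))⟩
  · have t0 := lt_half 0 s0
    have t1 := lt_half 1 s1
    have t2 := (half_lt 2 s2).le
    have t3 := (half_lt 3 s3).le
    have h8 := hcount 0 1 2 3 t0 t1 t2 t3 (by linarith)
    exact ⟨by simp only [t0, t1, not_lt.2 t2, not_lt.2 t3, if_true, if_false],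
      two_mul_count_neg_eq_four hprod (Or.inl (by linarith))⟩
  · linarith [half_lt 0 s0, half_lt 1 s1, half_lt 2 s2, half_lt 3 s3]
  · have t0 := lt_half 0 s0
    have t1 := (half_lt 1 s1).le
    have t2 := lt_half 2 s2
    have t3 := (half_lt 3 s3).le
    have h8 := hcount 0 2 1 3 t0 t2 t1 t3 (by linarith)
    exact ⟨by simp only [t0, t2, not_lt.2 t1, not_lt.2 t3, if_true, if_false],
      two_mul_count_neg_eq_four hprod (Or.inr (Or.inl (by linarith)))⟩
  · have t0 := (half_lt 0 s0).le
    have t1 := lt_half 1 s1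
    have t2 := lt_half 2 s2
    have t3 := (half_lt 3 s3).le
    have h8 := hcount 1 2 0 3 t1 t2 t0 t3 (by linarith)
    rw [add_comm (γ 1) (γ 0)] at h8
    exact ⟨by simp only [t1, t2, not_lt.2 t0, not_lt.2 t3, if_true, if_false],
      two_mul_count_neg_eq_four hprod (Or.inr (Or.inr (by linarith)))⟩

/-- The numerical criterion: positivity of the invariant form, in terms of its real parameters
`ρ₁, ρ₂, κ`, is equivalent to the condition on the two counts. Here `T` is the trace of `A`, the
numbers `yⱼ` are the roots of the resolvent cubic, and `h₁`, `h₂` express the values of the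
characteristic polynomial at `1` and `-1`. -/
theorem positivity_iff_counts {α : ℝ} (hα : α ∈ Set.Ioo (0 : ℝ) (1 / 2)) {γ : Fin 4 → ℝ}
    (hγ : ∀ i, γ i ∈ Set.Ioo (0 : ℝ) 1) {N : ℤ} (hN : γ 0 + γ 1 + γ 2 + γ 3 = N)
    {ρ₁ ρ₂ κ T y₁ y₂ y₃ : ℝ} (hT : T = 2 * Real.cos (2 * Real.pi * α))
    (hy₁ : y₁ = 2 * Real.cos (2 * Real.pi * (γ 0 + γ 1)))
    (hy₂ : y₂ = 2 * Real.cos (2 * Real.pi * (γ 0 + γ 2)))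
    (hy₃ : y₃ = 2 * Real.cos (2 * Real.pi * (γ 0 + γ 3)))
    (h₁ : 16 * (Real.sin (Real.pi * γ 0) * Real.sin (Real.pi * γ 1) *
        Real.sin (Real.pi * γ 2) * Real.sin (Real.pi * γ 3)) * Real.cos (Real.pi * N) =
      (2 - T) * ((1 + ρ₁) * (1 + ρ₂) - κ))
    (h₂ : 16 * (Real.cos (Real.pi * γ 0) * Real.cos (Real.pi * γ 1) *
        Real.cos (Real.pi * γ 2) * Real.cos (Real.pi * γ 3)) * Real.cos (Real.pi * N) =
      (2 - T) * ((1 - ρ₁) * (1 - ρ₂) - κ))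
    (h₃ : y₁ + y₂ + y₃ = (2 - T) * (ρ₁ * ρ₂ - κ) - T)
    (h₄ : κ * (2 - T) * (4 - T ^ 2) = (T + y₁) * (T + y₂) * (T + y₃))
    (hκ : κ ≠ 0) (h₅ : (1 - ρ₁) * (1 - ρ₂) - κ ≠ 0) :
    (0 < κ ∧ 0 < 1 + ρ₁ ∧ 0 < 1 - ρ₁ ∧ κ < (1 + ρ₁) * (1 + ρ₂) ∧ κ < (1 - ρ₁) * (1 - ρ₂)) ↔
      (countHalf γ, countPairs α γ) = (2, 4) := by
  have hπ := Real.pi_pos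
  obtain ⟨hα0, hα1⟩ := hα
  have hT2 : T < 2 := by
    have := Real.cos_lt_cos_of_nonneg_of_le_pi (x := 0) (y := 2 * Real.pi * α) le_rfl
      (by nlinarith) (by positivity)
    rw [Real.cos_zero] at this
    linarith
  have hT2' : -2 < T := by
    have := Real.cos_lt_cos_of_nonneg_of_le_pi (x := 2 * Real.pi * α) (y := Real.pi)
      (by positivity) le_rfl (by nlinarith)
    rw [Real.cos_pi] at this
    linarith
  have hTT : 0 < (2 - T) * (4 - T ^ 2) := mul_pos (by linarith) (by nlinarith)
  have hκ' : 0 < κ ↔ 0 < (T + y₁) * (T + y₂) * (T + y₃) := by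
    rw [← h₄, mul_assoc, mul_pos_iff_of_pos_right hTT]
  have hsin : ∀ i, 0 < Real.sin (Real.pi * γ i) := fun i =>
    Real.sin_pos_of_pos_of_lt_pi (mul_pos hπ (hγ i).1) (by nlinarith [(hγ i).2])
  have hcos1 : ∀ i, γ i < 1 / 2 → 0 < Real.cos (Real.pi * γ i) := fun i hi =>
    Real.cos_pos_of_mem_Ioo ⟨by nlinarith [(hγ i).1], by nlinarith⟩
  have hcos2 : ∀ i, 1 / 2 ≤ γ i → Real.cos (Real.pi * γ i) ≤ 0 := fun i hi =>
    Real.cos_nonpos_of_pi_div_two_le_of_le (by nlinarith) (by nlinarith [(hγ i).2])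
  have hS := mul_pos (mul_pos (mul_pos (hsin 0) (hsin 1)) (hsin 2)) (hsin 3)
  have g0 := hγ 0
  have g1 := hγ 1
  have g2 := hγ 2
  have g3 := hγ 3
  simp only [Set.mem_Ioo] at g0 g1 g2 g3
  have hN2 : N = 2 → Real.cos (Real.pi * N) = 1 := by
    rintro rfl
    rw [show Real.pi * ((2 : ℤ) : ℝ) = 2 * Real.pi by push_cast; ring, Real.cos_two_pi]
  rw [Prod.mk.injEq, countHalf_eq hγ, countPairs_eq ⟨hα0, hα1⟩ hN, ← hT, ← hy₁, ← hy₂, ← hy₃]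
  constructor
  · rintro ⟨hκ0, hp, hm, hp', hm'⟩
    have hρ₂p : 0 < 1 + ρ₂ := (mul_pos_iff_of_pos_left hp).1 (hκ0.trans hp')
    have hρ₂m : 0 < 1 - ρ₂ := (mul_pos_iff_of_pos_left hm).1 (hκ0.trans hm')
    have hN' : N = 2 := by
      have b1 : 0 < N := by
        have : (0 : ℝ) < N := by linarith
        exact_mod_cast this
      have b2 : N < 4 := by
        have : (N : ℝ) < 4 := by linarith
        exact_mod_cast this
      have hpos : 0 < Real.cos (Real.pi * N) := by
        have : 0 < 16 * (Real.sin (Real.pi * γ 0) * Real.sin (Real.pi * γ 1) *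
            Real.sin (Real.pi * γ 2) * Real.sin (Real.pi * γ 3)) * Real.cos (Real.pi * N) := by
          rw [h₁]
          exact mul_pos (by linarith) (by linarith)
        exact (mul_pos_iff_of_pos_left (by positivity)).1 this
      by_contra hne
      obtain rfl | rfl : N = 1 ∨ N = 3 := by omega
      · norm_num at hpos
      · rw [show Real.pi * ((3 : ℤ) : ℝ) = Real.pi + 2 * Real.pi by push_cast; ring,
          Real.cos_add_two_pi, Real.cos_pi] at hpos
        linarith
    have hcospos : 0 < Real.cos (Real.pi * γ 0) * Real.cos (Real.pi * γ 1) *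
        Real.cos (Real.pi * γ 2) * Real.cos (Real.pi * γ 3) := by
      rw [hN2 hN'] at h₂
      have : 0 < (2 - T) * ((1 - ρ₁) * (1 - ρ₂) - κ) := mul_pos (by linarith) (by linarith)
      linarith
    have hs : γ 0 + γ 1 + γ 2 + γ 3 = 2 := by rw [hN, hN']; norm_num
    have hdet : y₁ + y₂ + y₃ < 2 - 2 * T := by
      have h6 : ρ₁ * ρ₂ - κ < 1 := by
        linarith [mul_pos hp hρ₂m, mul_pos hm hρ₂p]
      have h7 := mul_lt_mul_of_pos_left h6 (show 0 < 2 - T by linarith)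
      linarith
    exact counts_of_cos_pos hγ hs hcospos hy₁ hy₂ hy₃ hdet (hκ'.1 hκ0)
  · rintro ⟨hn₁, hn₂⟩
    have hne : (T + y₁) * (T + y₂) * (T + y₃) ≠ 0 := by
      rw [← h₄, mul_assoc]
      exact mul_ne_zero hκ hTT.ne'
    obtain ⟨hprod, hneg⟩ := pos_of_two_mul_count_neg_eq_four hne hn₂
    have hκ0 := hκ'.2 hprod
    have hlt : ρ₁ * ρ₂ - κ < 1 := by
      have c₁ := Real.cos_le_one (2 * Real.pi * (γ 0 + γ 1))
      have c₂ := Real.cos_le_one (2 * Real.pi * (γ 0 + γ 2))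
      have c₃ := Real.cos_le_one (2 * Real.pi * (γ 0 + γ 3))
      have h6 : (2 - T) * (ρ₁ * ρ₂ - κ) < (2 - T) * 1 := by
        rcases hneg with h | h | h <;> linarith
      exact lt_of_mul_lt_mul_left h6 (by linarith)
    obtain ⟨b1, b2, hcospos⟩ := bounds_of_count_half_eq_two hγ hcos1 hcos2 hn₁
    have hN' : N = 2 := by
      rw [hN] at b1 b2
      have b1' : (1 : ℤ) < N := by exact_mod_cast b1
      have b2' : N < 3 := by exact_mod_cast b2
      omega
    rw [hN2 hN', mul_one] at h₁ h₂
    have hp' : κ < (1 + ρ₁) * (1 + ρ₂) := by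
      have : 0 < (2 - T) * ((1 + ρ₁) * (1 + ρ₂) - κ) := by rw [← h₁]; positivity
      linarith [(mul_pos_iff_of_pos_left (show 0 < 2 - T by linarith)).1 this]
    have hm' : κ < (1 - ρ₁) * (1 - ρ₂) := by
      have h7 : 0 ≤ (2 - T) * ((1 - ρ₁) * (1 - ρ₂) - κ) := by rw [← h₂]; positivity
      have h8 := (mul_nonneg_iff_of_pos_left (show 0 < 2 - T by linarith)).1 h7
      linarith [lt_of_le_of_ne h8 h₅.symm]
    -- Both factors of each product have the same sign, and `ρ₁ ρ₂ - κ < 1` excludes that both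
    -- `ρ₁, ρ₂ > 1` or both `ρ₁, ρ₂ < -1`.
    refine ⟨hκ0, ?_, ?_, hp', hm'⟩
    · rcases pos_and_pos_or_neg_and_neg_of_mul_pos (hκ0.trans hp') with h | h
      · exact h.1
      · linarith [h.1, h.2]
    · rcases pos_and_pos_or_neg_and_neg_of_mul_pos (hκ0.trans hm') with h | h
      · exact h.1
      · linarith [h.1, h.2]

/-! ### Existence and definiteness of the invariant form -/

theorem dualForm_det (ρ₁ ρ₂ ω : ℝ) (q : ℂ) : (dualForm ρ₁ ρ₂ ω q).det =
    ω ^ 2 * ((1 + ρ₁) * (1 + ρ₂) - ω * (q * conj q)) *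
      ((1 - ρ₁) * (1 - ρ₂) - ω * (q * conj q)) := by
  simp [dualForm, Matrix.det_succ_row_zero, Fin.sum_univ_succ, Fin.succAbove]
  ring

theorem dual_invariant_of_intertwining {C L T Y : Matrix (Fin 4) (Fin 4) ℂ} (hC : IsUnit C)
    (h : C * T = L * C) (hY : L * Y * Lᴴ = Y) :
    T * (C⁻¹ * Y * C⁻¹ᴴ) * Tᴴ = C⁻¹ * Y * C⁻¹ᴴ := by
  have hd : IsUnit C.det := (Matrix.isUnit_iff_isUnit_det _).1 hC
  have hT : T * C⁻¹ = C⁻¹ * L := by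
    calc T * C⁻¹ = C⁻¹ * (C * T) * C⁻¹ := by
          rw [← Matrix.mul_assoc C⁻¹, Matrix.nonsing_inv_mul _ hd, Matrix.one_mul]
      _ = C⁻¹ * L := by
          rw [h, Matrix.mul_assoc, Matrix.mul_assoc, Matrix.mul_nonsing_inv _ hd, Matrix.mul_one]
  calc T * (C⁻¹ * Y * C⁻¹ᴴ) * Tᴴ = (T * C⁻¹) * Y * (T * C⁻¹)ᴴ := by
        rw [Matrix.conjTranspose_mul]
        simp only [Matrix.mul_assoc]
    _ = C⁻¹ * (L * Y * Lᴴ) * C⁻¹ᴴ := by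
        rw [hT, Matrix.conjTranspose_mul]
        simp only [Matrix.mul_assoc]
    _ = C⁻¹ * Y * C⁻¹ᴴ := by rw [hY]

/-- The existence of the invariant form together with its definiteness criterion. By uniqueness it
suffices to know one invariant form explicitly. -/
theorem exists_invariantForm_isDefiniteForm_iff {α : ℝ} (hα : α ∈ Set.Ioo (0 : ℝ) (1 / 2))
    {γ : Fin 4 → ℝ} (hγ : ∀ i, γ i ∈ Set.Ioo (0 : ℝ) 1) {T₀ T₁ Tinf : GL (Fin 4) ℂ}
    (hT : IsGoursatII (circleExp α) (circleExp (1 - α)) (-1) (fun i => circleExp (γ i))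
      T₀ T₁ Tinf)
    (hirr : ActsIrreducibly (monodromyGroup T₀ T₁ Tinf)) :
    ∃ H, IsInvariantHermitianForm (monodromyGroup T₀ T₁ Tinf) H ∧
      (IsDefiniteForm H ↔ (countHalf γ, countPairs α γ) = (2, 4)) := by
  have hconj : circleExp (1 - α) = conj (circleExp α) := by
    have h1 : circleExp 1 = 1 := by simpa using circleExp_intCast 1
    rw [conj_circleExp, sub_eq_add_neg, circleExp_add, h1, one_mul]
  have hunit : ∀ x : ℝ, circleExp x * conj (circleExp x) = 1 := fun x => by
    rw [conj_circleExp, circleExp_neg, mul_inv_cancel₀ (circleExp_ne_zero x)]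
  have hτ : circleExp α + conj (circleExp α) = ((2 * Real.cos (2 * Real.pi * α) : ℝ) : ℂ) := by
    rw [conj_circleExp, circleExp_add_neg]
  rw [hconj] at hT
  have ha := hunit α
  obtain ⟨C, x, y, z, w, hC, h₀, h₁, hy, hz⟩ := exists_normalForm hT hirr
  have hpoly := normalForm_charpoly hT (fun i => circleExp_ne_zero _) hC h₀ h₁
  simp only [← circleExp_neg] at hpoly
  obtain ⟨N, hN⟩ : ∃ N : ℤ, γ 0 + γ 1 + γ 2 + γ 3 = N := by
    have h2 := hpoly 0
    have h3 : circleExp (-γ 0 + -γ 1 + -γ 2 + -γ 3) = 1 := by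
      rw [circleExp_add, circleExp_add, circleExp_add]
      linear_combination ha - h2
    obtain ⟨n, hn⟩ := exists_int_of_circleExp_eq_one h3
    exact ⟨-n, by push_cast; linarith⟩
  obtain ⟨ρ₁, ρ₂, κ, hx, hw, hyz, e₁, e₂, e₃, e₄⟩ := exists_real_parameters ha hT.a₁_ne_a₂
    (hunit _) (hunit _) (hunit _) (hunit _) hpoly
  -- The resolvent roots are real because complementary pairs of eigenvalues are conjugate.
  have hpair : ∀ i j k l : Fin 4, γ i + γ j + γ k + γ l = N →
      circleExp (-γ i) * circleExp (-γ j) + circleExp (-γ k) * circleExp (-γ l) =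
        ((2 * Real.cos (2 * Real.pi * (γ i + γ j)) : ℝ) : ℂ) := by
    intro i j k l h
    have h2 : circleExp (-γ k + -γ l) = circleExp (γ i + γ j) := by
      have h3 := circleExp_intCast (-N)
      rw [show -γ k + -γ l = γ i + γ j + ((-N : ℤ) : ℝ) by push_cast; linarith, circleExp_add, h3,
        mul_one]
    rw [← circleExp_add, ← circleExp_add, h2, ← circleExp_add_neg, neg_add, add_comm]
  rw [hpair 0 1 2 3 hN, hpair 0 2 1 3 (by linarith), hpair 0 3 1 2 (by linarith), hτ] at e₃ e₄
  rw [prod_one_sub_circleExp_neg hN, hτ] at e₁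
  rw [prod_one_add_circleExp_neg hN, hτ] at e₂
  have hc1 : conj (circleExp α) - 1 ≠ 0 := sub_ne_zero.2 hT.a₂_ne_one
  have ha1 : circleExp α - 1 ≠ 0 := sub_ne_zero.2 hT.a₁_ne_one
  have hκ : κ ≠ 0 := by
    rintro rfl
    exact mul_ne_zero hy hz (by rw [hyz]; simp)
  obtain ⟨q, hq⟩ : ∃ q, y = q * (conj (circleExp α) - 1) :=
    ⟨y / (conj (circleExp α) - 1), by field_simp⟩
  have hq0 : q ≠ 0 := by
    rintro rfl
    exact hy (by rw [hq, zero_mul])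
  have hn0 : Complex.normSq q ≠ 0 := (Complex.normSq_pos.2 hq0).ne'
  obtain ⟨ω, hω⟩ : ∃ ω : ℝ, κ = ω * Complex.normSq q := ⟨κ / Complex.normSq q, by field_simp⟩
  have hω' : (κ : ℂ) = ω * (q * conj q) := by
    rw [Complex.mul_conj, hω, Complex.ofReal_mul]
  have hz' : z = ω * conj q * (circleExp α - 1) := by
    refine mul_left_cancel₀ (mul_ne_zero hq0 hc1) ?_
    rw [hq, hω'] at hyz
    linear_combination hyz - ω * (q * conj q) * ha
  rw [hx, hq, hz', hw] at h₀
  have i₀ := dual_invariant_of_intertwining hC h₀ (blockLower_mul_dualForm ha ρ₁ ρ₂ ω q)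
  have i₁ := dual_invariant_of_intertwining hC h₁ (blockSwap_mul_dualForm ρ₁ ρ₂ ω q)
  have hCi : IsUnit C⁻¹ := by
    rw [Matrix.isUnit_nonsing_inv_iff]
    exact hC
  have hYne : C⁻¹ * dualForm ρ₁ ρ₂ ω q * C⁻¹ᴴ ≠ 0 := by
    intro h
    have hCi' : IsUnit C⁻¹ᴴ := (Matrix.isUnit_conjTranspose _).2 hCi
    rw [hCi'.mul_left_eq_zero, hCi.mul_right_eq_zero] at h
    exact dualForm_ne_zero _ _ _ _ h
  have hYu := isUnit_of_dual_invariant hT.prod_eq_one hirr hYne i₀ i₁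
  have hYh : (C⁻¹ * dualForm ρ₁ ρ₂ ω q * C⁻¹ᴴ).IsHermitian :=
    Matrix.isHermitian_mul_mul_conjTranspose _ (dualForm_isHermitian ρ₁ ρ₂ ω q)
  have h₅ : (1 - ρ₁) * (1 - ρ₂) - κ ≠ 0 := by
    intro h
    have hd := ((Matrix.isUnit_iff_isUnit_det _).1 hYu).ne_zero
    have h5 : ((1 - ρ₁) * (1 - ρ₂) - ω * (q * conj q) : ℂ) = 0 := by
      rw [← hω']
      exact_mod_cast h
    rw [Matrix.det_mul, Matrix.det_mul, dualForm_det, h5] at hd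
    simp at hd
  refine ⟨(C⁻¹ * dualForm ρ₁ ρ₂ ω q * C⁻¹ᴴ)⁻¹, ⟨?_, hYh.inv, ?_⟩, ?_⟩
  · exact (Matrix.isUnit_nonsing_inv_iff.2 hYu).ne_zero
  · exact invariant_of_generators hT.prod_eq_one (inv_invariant_of_dual_invariant hYu i₀)
      (inv_invariant_of_dual_invariant hYu i₁)
  · rw [isDefiniteForm_inv_iff hYu, isDefiniteForm_mul_mul_conjTranspose_iff hCi,
      dualForm_isDefiniteForm_iff hq0 hω]
    exact positivity_iff_counts hα hγ hN rfl rfl rfl rfl (by exact_mod_cast e₁)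
      (by exact_mod_cast e₂) (by exact_mod_cast e₃) (by exact_mod_cast e₄) hκ h₅

theorem mainTheorem3 (α : ℝ) (hα : α ∈ Set.Ioo (0 : ℝ) (1 / 2))
    (γ : Fin 4 → ℝ) (hγ : ∀ i, γ i ∈ Set.Ioo (0 : ℝ) 1)
    (T₀ T₁ Tinf : GL (Fin 4) ℂ)
    (hT : IsGoursatII (circleExp α) (circleExp (1 - α)) (-1) (fun i => circleExp (γ i))
      T₀ T₁ Tinf)
    (hirr : ActsIrreducibly (monodromyGroup T₀ T₁ Tinf)) :
    (∃ H, IsInvariantHermitianForm (monodromyGroup T₀ T₁ Tinf) H) ∧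
    (∀ H H', IsInvariantHermitianForm (monodromyGroup T₀ T₁ Tinf) H →
      IsInvariantHermitianForm (monodromyGroup T₀ T₁ Tinf) H' →
        ∃ r : ℝ, r ≠ 0 ∧ H' = (r : ℂ) • H) ∧
    (∀ H, IsInvariantHermitianForm (monodromyGroup T₀ T₁ Tinf) H →
      (IsDefiniteForm H ↔ (countHalf γ, countPairs α γ) = (2, 4))) := by
  obtain ⟨H₀, hH₀, hiff⟩ := exists_invariantForm_isDefiniteForm_iff hα hγ hT hirr
  refine ⟨⟨H₀, hH₀⟩, fun H H' h h' => h.eq_real_smul hirr h', fun H h => ?_⟩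
  obtain ⟨r, hr, rfl⟩ := hH₀.eq_real_smul hirr h
  rw [isDefiniteForm_real_smul_iff hr, hiff]
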